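/- **Setting.** Let $\mathcal P=\{P_1,\dots,P_N\}$ be a finite set of players and $\Gamma$ a nonempty family of nonempty subsets of $\mathcal P$ (the authorized sets). A *sharing scheme* for a secret of dimension $d\ge 2$ is a quantum operation (completely positive trace-preserving map) that encodes a $d$-dimensional secret state into finitely many finite-dimensional shares, each of which is given to a player or kept by the dealer; a player may hold several shares. The shares kept by the dealer are called *resident shares*. The scheme is an *assisted quantum secret sharing (AQSS) scheme* for $\Gamma$ if, for every $A\subseteq\mathcal P$: when $A\in\Gamma$, some quantum operation on the shares of $A$ together with the resident shares restores every secret state; when $A\notin\Gamma$, the joint reduced state of these shares does not depend on the secret. It is a *conventional* QSS scheme if there are no resident shares. A $((k,n))$ *threshold scheme* encodes the secret into $n$ shares so that any $k$ or more of them restore the secret and the joint state of fewer than $k$ of them does not depend on the secret. A *partial link classification* of a family $G$ of sets is a partition of $G$ into nonempty classes such that (a) any two sets in the same class intersect, and (b) for any two distinct classes, some set of one is disjoint from some set of the other. Let $\lambda(G)$ be the smallest number of classes in a partial link classification of $G$. (Equivalently, $\lambda(G)$ is the least number of cliques into which the graph on $G$ whose edges join intersecting sets can be partitioned.) The family $\Gamma$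 is *monotone* if every superset (within $\mathcal P$) of a member of $\Gamma$ is in $\Gamma$. A subfamily $G\subseteq\Gamma$ *generates* $\Gamma$ if every member of $\Gamma$ contains a member of $G$. **Theorem.** 1. For every $d\ge 2$, an AQSS scheme for $\Gamma$ with a $d$-dimensional secret exists if and only if $\Gamma$ is monotone. (The authorized sets need not overlap pairwise.) Suppose now that $\Gamma$ is monotone, let $G=\{\alpha_1,\dots,\alpha_r\}\subseteq\Gamma$ be any generating subfamily (for example $G=\Gamma$, or the minimal authorized sets), and put $\lambda=\lambda(G)$. 2. For every $d\ge2$ there is an AQSS scheme for $\Gamma$ with a $d$-dimensional secret and at most $\lambda-1$ resident shares. 3. Let $C_1,\dots,C_\lambda$ be any partial link classification of $G$ with $\lambda$ classes, let $d\ge 2$, and let $q$ be any prime with $q\ge d$ and $q\ge 2\lambda-1$. Then there are a $((\lambda,2\lambda-1))$ threshold scheme for a $d$-dimensional secret with $q$-dimensional shares and, for each $i$, a conventional QSS scheme with a $q$-dimensional secret and $q$-dimensional shares, whose authorized sets are exactly the sets of players that contain a member of $C_i$, such that the following concatenation is an AQSS scheme for $\Gamma$ with exactly $\lambda-1$ resident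 shares: encode the secret by the threshold scheme; assign one of its shares to each class $C_i$ and distribute that share among the players by the scheme for $C_i$; leave the other $\lambda-1$ shares with the dealer. -/

import Mathlib

open scoped Matrix ComplexOrder

/-! ### Quantum states and operations on finite-dimensional systems

A system with orthonormal basis indexed by a finite type `a` has operators `Matrix a a ℂ`. -/

/-- Density matrices: positive semidefinite of trace one. -/
def IsDensity {a : Type} [Fintype a] (ρ : Matrix a a ℂ) : Prop :=
  ρ.PosSemidef ∧ ρ.trace = 1

/-- Quantum operations (completely positive trace-preserving maps), in operator-sum form
`ρ ↦ ∑ K_e ρ K_e†` with `∑ K_e† K_e = 1`. -/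
def IsChannel {a b : Type} [Fintype a] [DecidableEq a] [Fintype b]
    (Φ : Matrix a a ℂ →ₗ[ℂ] Matrix b b ℂ) : Prop :=
  ∃ (E : Type) (_ : Fintype E) (K : E → Matrix b a ℂ),
    (∑ e, (K e)ᴴ * K e = 1) ∧ ∀ ρ, Φ ρ = ∑ e, K e * ρ * (K e)ᴴ

theorem IsChannel.comp {a b c : Type} [Fintype a] [DecidableEq a] [Fintype b] [DecidableEq b]
    [Fintype c] {Φ : Matrix a a ℂ →ₗ[ℂ] Matrix b b ℂ} {Ψ : Matrix b b ℂ →ₗ[ℂ] Matrix c c ℂ}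
    (hΨ : IsChannel Ψ) (hΦ : IsChannel Φ) : IsChannel (Ψ ∘ₗ Φ) := by
  obtain ⟨E, _, K, hK, hΦ⟩ := hΦ
  obtain ⟨F, _, L, hL, hΨ⟩ := hΨ
  refine ⟨E × F, inferInstance, fun p => L p.2 * K p.1, ?_, fun ρ => ?_⟩
  · rw [Fintype.sum_prod_type, ← hK]
    refine Finset.sum_congr rfl fun e _ => ?_
    have : ∀ f, (L f * K e)ᴴ * (L f * K e) = (K e)ᴴ * ((L f)ᴴ * L f) * K e := by
      intro f
      simp only [Matrix.conjTranspose_mul, Matrix.mul_assoc]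
    simp only [this]
    rw [← Matrix.sum_mul, ← Matrix.mul_sum, hL, Matrix.mul_one]
  · rw [LinearMap.comp_apply, hΨ, hΦ, Fintype.sum_prod_type, Finset.sum_comm]
    refine Finset.sum_congr rfl fun f _ => ?_
    rw [Matrix.mul_sum, Matrix.sum_mul]
    refine Finset.sum_congr rfl fun e _ => ?_
    simp only [Matrix.conjTranspose_mul, Matrix.mul_assoc]

/-- Relabelling of the basis of a system. -/
def relabel {a b : Type} (f : a ≃ b) : Matrix a a ℂ →ₗ[ℂ] Matrix b b ℂ :=
  (Matrix.reindexLinearEquiv ℂ ℂ f f).toLinearMap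

theorem relabel_isChannel {a b : Type} [Fintype a] [DecidableEq a] [Fintype b] (f : a ≃ b) :
    IsChannel (relabel f) := by
  refine ⟨Unit, inferInstance, fun _ => (1 : Matrix a a ℂ).submatrix f.symm id, ?_, fun ρ => ?_⟩
  · ext u v
    simp [Matrix.one_apply]
  · ext x y
    simp [relabel, Matrix.mul_apply, Matrix.one_apply]

/-- Tensor product of linear maps on operators: the linear map that sends the matrix unit
`⨂ j, |u j⟩⟨v j|` to `⨂ j, Φ j (|u j⟩⟨v j|)`. -/
def tensorMap {J : Type} [Fintype J] [DecidableEq J] {a b : J → Type}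
    [∀ j, Fintype (a j)] [∀ j, DecidableEq (a j)]
    (Φ : ∀ j, Matrix (a j) (a j) ℂ →ₗ[ℂ] Matrix (b j) (b j) ℂ) :
    Matrix (∀ j, a j) (∀ j, a j) ℂ →ₗ[ℂ] Matrix (∀ j, b j) (∀ j, b j) ℂ where
  toFun X := Matrix.of fun x y =>
    ∑ u, ∑ v, X u v * ∏ j, Φ j (Matrix.single (u j) (v j) 1) (x j) (y j)
  map_add' X Y := by
    ext x y
    simp [add_mul, Finset.sum_add_distrib]
  map_smul' c X := by
    ext x y
    simp [Finset.mul_sum, mul_assoc]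

theorem tensorMap_isChannel {J : Type} [Fintype J] [DecidableEq J] {a b : J → Type}
    [∀ j, Fintype (a j)] [∀ j, DecidableEq (a j)] [∀ j, Fintype (b j)]
    (Φ : ∀ j, Matrix (a j) (a j) ℂ →ₗ[ℂ] Matrix (b j) (b j) ℂ) (h : ∀ j, IsChannel (Φ j)) :
    IsChannel (tensorMap Φ) := by
  choose E hE K hK hΦ using h
  refine ⟨∀ j, E j, inferInstance, fun e => Matrix.of fun x u => ∏ j, K j (e j) (x j) (u j),
    ?_, fun ρ => ?_⟩
  · ext u v
    have key : ∀ j, ∑ e, ∑ x, star (K j e x (u j)) * K j e x (v j)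
        = (1 : Matrix (a j) (a j) ℂ) (u j) (v j) := by
      intro j
      rw [← hK j]
      simp [Matrix.sum_apply, Matrix.mul_apply]
    have h1 : (1 : Matrix (∀ j, a j) (∀ j, a j) ℂ) u v
        = ∏ j, (1 : Matrix (a j) (a j) ℂ) (u j) (v j) := by
      simp only [Matrix.one_apply, Finset.prod_ite_zero, funext_iff]
      simp
    rw [h1]
    simp only [← key]
    rw [Fintype.prod_sum]
    simp only [Fintype.prod_sum, Matrix.sum_apply, Matrix.mul_apply, Matrix.conjTranspose_apply,
      Matrix.of_apply, Finset.prod_mul_distrib, star_prod]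
  · ext x y
    have key : ∀ j (p q : a j), Φ j (Matrix.single p q 1) (x j) (y j)
        = ∑ e, K j e (x j) p * star (K j e (y j) q) := by
      intro j p q
      rw [hΦ]
      simp [Matrix.sum_apply, Matrix.mul_apply, Matrix.single_apply, ite_and]
    simp only [tensorMap, LinearMap.coe_mk, AddHom.coe_mk, Matrix.of_apply, key,
      Fintype.prod_sum, Matrix.sum_apply, Matrix.mul_apply, Matrix.conjTranspose_apply,
      Finset.mul_sum, Finset.sum_mul, star_prod, Finset.prod_mul_distrib]
    rw [Finset.sum_comm]
    simp only [Finset.sum_comm (s := (Finset.univ : Finset (∀ j, E j)))]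
    refine Finset.sum_congr rfl fun v _ => Finset.sum_congr rfl fun u _ =>
      Finset.sum_congr rfl fun e _ => ?_
    ring

/-! ### Encodings of a secret into shares -/

/-- Partial trace onto the shares in `A`: the reduced state of these shares. -/
def reduce {ι : Type} [Fintype ι] [DecidableEq ι] {δ : ι → ℕ} (A : Finset ι)
    (ρ : Matrix (∀ s, Fin (δ s)) (∀ s, Fin (δ s)) ℂ) :
    Matrix (∀ s : {s // s ∈ A}, Fin (δ s)) (∀ s : {s // s ∈ A}, Fin (δ s)) ℂ :=
  Matrix.of fun x y => ∑ z : (∀ s : {s // s ∉ A}, Fin (δ s)),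
    ρ ((Equiv.piEquivPiSubtypeProd (fun s => s ∈ A) fun s => Fin (δ s)).symm (x, z))
      ((Equiv.piEquivPiSubtypeProd (fun s => s ∈ A) fun s => Fin (δ s)).symm (y, z))

/-- A quantum operation that encodes a `d`-dimensional secret into shares indexed by `ι`,
the share `s` being a system of dimension `δ s`. -/
structure Encoding (d : ℕ) (ι : Type) [Fintype ι] [DecidableEq ι] (δ : ι → ℕ) where
  enc : Matrix (Fin d) (Fin d) ℂ →ₗ[ℂ] Matrix (∀ s, Fin (δ s)) (∀ s, Fin (δ s)) ℂ
  isChannel : IsChannel enc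

namespace Encoding

variable {d : ℕ} {ι : Type} [Fintype ι] [DecidableEq ι] {δ : ι → ℕ}

/-- The shares in `A` together determine the secret: some quantum operation on these shares
alone restores every secret state. -/
def Recovers (T : Encoding d ι δ) (A : Finset ι) : Prop :=
  ∃ R : Matrix (∀ s : {s // s ∈ A}, Fin (δ s)) (∀ s : {s // s ∈ A}, Fin (δ s)) ℂ →ₗ[ℂ]
      Matrix (Fin d) (Fin d) ℂ,
    IsChannel R ∧ ∀ ρ, IsDensity ρ → R (reduce A (T.enc ρ)) = ρ

/-- The shares in `A` together carry no information about the secret: their joint state does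
not depend on it. -/
def NoInfo (T : Encoding d ι δ) (A : Finset ι) : Prop :=
  ∃ σ, ∀ ρ, IsDensity ρ → reduce A (T.enc ρ) = σ

/-- A quantum `((k, n))` threshold scheme: there are `n` shares, any `k` or more of them restore
the secret, and fewer than `k` of them have no information about it. -/
def IsThreshold (T : Encoding d ι δ) (k n : ℕ) : Prop :=
  Fintype.card ι = n ∧ ∀ A : Finset ι,
    (k ≤ A.card → T.Recovers A) ∧ (A.card < k → T.NoInfo A)

end Encoding

/-! ### Assisted quantum secret sharing -/

/-- A distribution of a `d`-dimensional secret among the players `Fin N` and the dealer. Each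
share is held by a player (`some p`) or is kept by the dealer (`none`); a player may hold several
shares. -/
structure SharingScheme (N d : ℕ) where
  Share : Type
  [fintypeShare : Fintype Share]
  [decidableEqShare : DecidableEq Share]
  dim : Share → ℕ
  holder : Share → Option (Fin N)
  encoding : Encoding d Share dim

attribute [instance] SharingScheme.fintypeShare SharingScheme.decidableEqShare

namespace SharingScheme

variable {N d : ℕ}

/-- The resident shares, i.e. those withheld by the dealer. -/
def residents (S : SharingScheme N d) : Finset S.Share :=
  Finset.univ.filter fun s => S.holder s = none

/-- The shares of the players in `A` together with the resident shares. -/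
def available (S : SharingScheme N d) (A : Finset (Fin N)) : Finset S.Share :=
  Finset.univ.filter fun s => S.holder s = none ∨ ∃ p ∈ A, S.holder s = some p

/-- `S` is an assisted quantum secret sharing scheme with family of authorized sets `Γ`: with the
help of the resident shares, the sets in `Γ` restore the secret, and all other sets have no
information about it. -/
def Realizes (S : SharingScheme N d) (Γ : Set (Finset (Fin N))) : Prop :=
  ∀ A : Finset (Fin N),
    (A ∈ Γ → S.encoding.Recovers (S.available A)) ∧
      (A ∉ Γ → S.encoding.NoInfo (S.available A))

/-- `S` is a conventional quantum secret sharing scheme for `Γ`: no share stays with the dealer. -/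
def RealizesConventionally (S : SharingScheme N d) (Γ : Set (Finset (Fin N))) : Prop :=
  S.Realizes Γ ∧ S.residents = ∅

/-- The dealer keeps the secret as a single resident share. -/
def keep (N d : ℕ) : SharingScheme N d where
  Share := Unit
  dim _ := d
  holder _ := none
  encoding :=
    { enc := relabel (Equiv.funUnique Unit (Fin d)).symm
      isChannel := relabel_isChannel _ }

/-- Concatenation: the secret is encoded by `T`, and then the share `j` of `T` is itself
distributed as a secret by the scheme `S j`, independently for different `j`. -/
def concat {J : Type} [Fintype J] [DecidableEq J] {δ : J → ℕ} (T : Encoding d J δ)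
    (S : ∀ j, SharingScheme N (δ j)) : SharingScheme N d where
  Share := Σ j, (S j).Share
  dim s := (S s.1).dim s.2
  holder s := (S s.1).holder s.2
  encoding :=
    { enc := relabel (Equiv.piCurry fun j (s : (S j).Share) => Fin ((S j).dim s)).symm ∘ₗ
        tensorMap (fun j => (S j).encoding.enc) ∘ₗ T.enc
      isChannel := (relabel_isChannel _).comp
        ((tensorMap_isChannel _ fun j => (S j).encoding.isChannel).comp T.isChannel) }

end SharingScheme

/-! ### Partially linked classes -/

/-- `π` is a partial link classification of the family `G`: a partition of `G` into (nonempty)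
classes such that any two sets in one class overlap, while for any two distinct classes some set
of the one is disjoint from some set of the other. -/
def IsPartialLinkClassification {N : ℕ} {G : Finset (Finset (Fin N))} (π : Finpartition G) : Prop :=
  (∀ c ∈ π.parts, ∀ α ∈ c, ∀ β ∈ c, (α ∩ β).Nonempty) ∧
    ∀ c ∈ π.parts, ∀ c' ∈ π.parts, c ≠ c' → ∃ α ∈ c, ∃ β ∈ c', α ∩ β = ∅

/-- The least number of classes in a partial link classification of `G`. -/
noncomputable def linkNumber {N : ℕ} (G : Finset (Finset (Fin N))) : ℕ :=
  sInf {k | ∃ π : Finpartition G, IsPartialLinkClassification π ∧ π.parts.card = k}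

/-! ### Channels that act on basis labels -/

/-! Monotonicity is forced: an operation that restores the secret from some shares still works when
more shares are present, while a joint state independent of the secret cannot restore two different
basis states, which exist since `d ≥ 2`.

Conversely, let `G` be split into `l` classes of pairwise intersecting sets. The outer `((l, 2l -
1))` scheme gives one share to each class and `l - 1` to the dealer. A player set containing a
member of `G` rebuilds the share of that member's class, and with the residents has `l` shares. Any
other set learns nothing about the share of any class, so it faces only the `l - 1` resident shares
plus systems in a fixed state. Part 1 is the case `G = Γ`.

Both layers are coset codes: `|s⟩` becomes the uniform superposition over `W + v s` for an additive
group `W`. If the coordinates in `A` determine `s`, and the representatives can be moved inside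
their cosets to be supported on `A`, then `A` decodes `s` and subtracts the representative, which
leaves the secret unentangled with the rest (`codeEncoding_recovers`). If the complement of `B` has
both properties, `B` sees a fixed state (`codeEncoding_noInfo`). For the outer layer the code
consists of polynomials with the secret as leading coefficient (`exists_isThreshold`); for the inner
layer it lives on a square array whose rows decode and whose columns shift
(`exists_realizesConventionally`). The lemmas `concat_recovers` and `concat_noInfo` combine the
layers. -/

theorem sum_sum_comm {a b : Type} [Fintype a] [Fintype b] (F : b → b → a → a → ℂ) :
    ∑ i, ∑ j, ∑ x, ∑ y, F i j x y = ∑ x, ∑ y, ∑ i, ∑ j, F i j x y := by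
  simp only [Finset.sum_comm (s := (Finset.univ : Finset b)) (t := (Finset.univ : Finset a))]

section LabelMap
open Classical

/-- The operation that relabels the basis state `x` as `f x ⊗ g x` and discards the second
factor. -/
noncomputable def labelMap {a b e : Type} [Fintype a] (f : a → b) (g : a → e) :
    Matrix a a ℂ →ₗ[ℂ] Matrix b b ℂ where
  toFun X := Matrix.of fun i j => ∑ x, ∑ y, if f x = i ∧ f y = j ∧ g x = g y then X x y else 0
  map_add' X Y := by
    ext i j
    simp only [Matrix.of_apply, Matrix.add_apply, ← Finset.sum_add_distrib]
    refine Finset.sum_congr rfl fun x _ => Finset.sum_congr rfl fun y _ => ?_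
    split_ifs <;> simp
  map_smul' c X := by
    ext i j
    simp [Finset.mul_sum]

theorem labelMap_apply {a b e : Type} [Fintype a] (f : a → b) (g : a → e)
    (X : Matrix a a ℂ) (i j : b) : labelMap f g X i j =
      ∑ x, ∑ y, if f x = i ∧ f y = j ∧ g x = g y then X x y else 0 := rfl

/-- Joint injectivity makes `x ↦ |f x⟩ ⊗ |g x⟩` an isometry; the Kraus operators are indexed by the
values of the discarded label. -/
theorem labelMap_isChannel {a b e : Type} [Fintype a] [DecidableEq a] [Fintype b] [Fintype e]
    (f : a → b) (g : a → e) (h : ∀ x y, f x = f y → g x = g y → x = y) :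
    IsChannel (labelMap f g) := by
  refine ⟨e, inferInstance, fun k => Matrix.of fun i x => if f x = i ∧ g x = k then 1 else 0,
    ?_, fun ρ => ?_⟩
  · ext x y
    simp only [Matrix.sum_apply, Matrix.mul_apply, Matrix.conjTranspose_apply, Matrix.of_apply,
      apply_ite star, star_one, star_zero, ite_mul, one_mul, zero_mul, ← ite_and]
    rw [Finset.sum_comm, Finset.sum_eq_single (f x), Finset.sum_eq_single (g x)]
    · rw [Matrix.one_apply]
      refine if_congr ⟨fun hh => ?_, fun hh => ?_⟩ rfl rfl
      · exact h _ _ hh.2.1.symm hh.2.2.symm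
      · subst hh; simp
    · intro k _ hk
      rw [if_neg]; rintro ⟨⟨_, h2⟩, _⟩; exact hk h2.symm
    · simp
    · intro i _ hi
      refine Finset.sum_eq_zero fun k _ => ?_
      rw [if_neg]; rintro ⟨⟨h2, _⟩, _⟩; exact hi h2.symm
    · simp
  · ext i j
    simp only [labelMap_apply, Matrix.sum_apply, Matrix.mul_apply, Matrix.conjTranspose_apply,
      Matrix.of_apply, Finset.sum_mul]
    rw [Finset.sum_comm, Finset.sum_comm (s := (Finset.univ : Finset e))]
    refine Finset.sum_congr rfl fun y _ => ?_
    rw [Finset.sum_comm]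
    refine Finset.sum_congr rfl fun x _ => ?_
    rw [Finset.sum_eq_single (g x)]
    · by_cases h1 : f x = i <;> by_cases h2 : f y = j <;> by_cases h3 : g x = g y <;>
        simp [h1, h2, h3, eq_comm (a := g y)]
    · intro k _ hk
      simp [Ne.symm hk]
    · simp

/-- The discarded label matters only through the partition it induces, so two descriptions of the
environment agree when they separate the same basis states. -/
theorem labelMap_congr {a b e e' : Type} [Fintype a] {f f' : a → b} {g : a → e} {g' : a → e'}
    (hf : ∀ x, f x = f' x) (hg : ∀ x y, g x = g y ↔ g' x = g' y) :
    labelMap f g = labelMap f' g' := by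
  ext X i j
  simp only [labelMap_apply, hf, hg]

theorem labelMap_comp {a b c e e' : Type} [Fintype a] [Fintype b] (f : a → b) (g : a → e)
    (f' : b → c) (g' : b → e') :
    labelMap f' g' ∘ₗ labelMap f g = labelMap (f' ∘ f) (fun x => (g' (f x), g x)) := by
  apply LinearMap.ext
  intro X
  ext k l
  simp only [LinearMap.comp_apply, labelMap_apply, Function.comp_apply, Prod.mk.injEq]
  have : ∀ i j : b, (if f' i = k ∧ f' j = l ∧ g' i = g' j then ∑ x, ∑ y,
      if f x = i ∧ f y = j ∧ g x = g y then X x y else 0 else 0) = ∑ x, ∑ y,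
      if f y = j then (if f x = i then (if f' i = k ∧ f' j = l ∧ g' i = g' j ∧ g x = g y
        then X x y else 0) else 0) else 0 := by
    intro i j
    split_ifs with h
    · refine Finset.sum_congr rfl fun x _ => Finset.sum_congr rfl fun y _ => ?_
      by_cases h1 : f x = i <;> by_cases h2 : f y = j <;> simp [h1, h2, h]
    · symm
      refine Finset.sum_eq_zero fun x _ => Finset.sum_eq_zero fun y _ => ?_
      have : ¬ (f' i = k ∧ f' j = l ∧ g' i = g' j ∧ g x = g y) := by tauto
      simp [this]
  simp only [this]
  rw [sum_sum_comm]
  simp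

theorem labelMap_reindex {a a' b e : Type} [Fintype a] [Fintype a'] (σ : a' ≃ a) (f : a → b)
    (g : a → e) (X : Matrix a a ℂ) :
    labelMap f g X = labelMap (f ∘ σ) (g ∘ σ) (X.submatrix σ σ) := by
  ext i j
  simp only [labelMap_apply, Function.comp_apply, Matrix.submatrix_apply]
  rw [← σ.sum_comp]
  exact Finset.sum_congr rfl fun x _ => (σ.sum_comp _).symm

theorem relabel_eq_labelMap {a b : Type} [Fintype a] (f : a ≃ b) :
    relabel f = labelMap f (fun _ => ()) := by
  ext X i j
  simp only [labelMap_apply, relabel]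
  rw [Finset.sum_eq_single (f.symm i), Finset.sum_eq_single (f.symm j)]
  · simp
  · intro y _ hy
    rw [if_neg]; rintro ⟨_, h, _⟩; exact hy (by simp [← h])
  · simp
  · intro y _ hy
    refine Finset.sum_eq_zero fun k _ => ?_
    rw [if_neg]; rintro ⟨h, _, _⟩; exact hy (by simp [← h])
  · simp

variable {ι : Type} [Fintype ι] [DecidableEq ι] {δ : ι → ℕ}

theorem reduce_eq_labelMap (A : Finset ι) (ρ : Matrix (∀ s, Fin (δ s)) (∀ s, Fin (δ s)) ℂ) :
    reduce A ρ = labelMap (fun x (s : {s // s ∈ A}) => x s.1)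
      (fun x (s : {s // s ∉ A}) => x s.1) ρ := by
  ext x y
  simp only [labelMap_apply, reduce, Matrix.of_apply]
  rw [← (Equiv.piEquivPiSubtypeProd (fun s => s ∈ A) fun s => Fin (δ s)).symm.sum_comp,
    Fintype.sum_prod_type, Finset.sum_eq_single x]
  · refine Finset.sum_congr rfl fun z _ => ?_
    rw [← (Equiv.piEquivPiSubtypeProd (fun s => s ∈ A) fun s => Fin (δ s)).symm.sum_comp,
      Fintype.sum_prod_type, Finset.sum_eq_single y, Finset.sum_eq_single z]
    · rw [if_pos]
      refine ⟨?_, ?_, ?_⟩ <;> ext s <;> simp [s.2]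
    · intro z' _ hz
      rw [if_neg]
      rintro ⟨_, _, h⟩
      refine hz (funext fun s => ?_)
      have := congrFun h s
      simpa [s.2] using this.symm
    · simp
    · intro y' _ hy
      refine Finset.sum_eq_zero fun k _ => ?_
      rw [if_neg]
      rintro ⟨_, h, _⟩
      refine hy (funext fun s => ?_)
      have := congrFun h s
      simpa [s.2] using this
    · simp
  · intro y' _ hy
    refine Finset.sum_eq_zero fun k _ => Finset.sum_eq_zero fun k _ => ?_
    rw [if_neg]
    rintro ⟨h, _, _⟩
    refine hy (funext fun s => ?_)
    have := congrFun h s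
    simpa [s.2] using this
  · simp

/-- Partial trace onto the shares in `A` as a linear map. -/
noncomputable def reduceMap (δ : ι → ℕ) (A : Finset ι) :
    Matrix (∀ s, Fin (δ s)) (∀ s, Fin (δ s)) ℂ →ₗ[ℂ]
      Matrix (∀ s : {s // s ∈ A}, Fin (δ s)) (∀ s : {s // s ∈ A}, Fin (δ s)) ℂ :=
  labelMap (fun x s => x s.1) (fun x (s : {s // s ∉ A}) => x s.1)

theorem reduce_eq_reduceMap (A : Finset ι)
    (ρ : Matrix (∀ s, Fin (δ s)) (∀ s, Fin (δ s)) ℂ) : reduce A ρ = reduceMap δ A ρ :=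
  reduce_eq_labelMap A ρ

theorem reduceMap_isChannel (A : Finset ι) : IsChannel (reduceMap δ A) := by
  refine labelMap_isChannel _ _ fun x y h1 h2 => funext fun s => ?_
  by_cases hs : s ∈ A
  · exact congrFun h1 ⟨s, hs⟩
  · exact congrFun h2 ⟨s, hs⟩

end LabelMap

/-! ### Density matrices span all operators -/

theorem isDensity_vecMulVec {n : Type} [Fintype n] (x : n → ℂ) (h : x ⬝ᵥ star x = 1) :
    IsDensity (Matrix.vecMulVec x (star x)) :=
  ⟨Matrix.posSemidef_vecMulVec_self_star x, by rw [Matrix.trace_vecMulVec, h]⟩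

/-- After normalization the hypothesis covers every `|x⟩⟨x|`, and polarization yields the matrix
units. Statements about states thereby become equations between linear maps. -/
theorem linearMap_ext_isDensity {n : Type} [Fintype n] [DecidableEq n] {V : Type*}
    [AddCommGroup V] [Module ℂ V] {f g : Matrix n n ℂ →ₗ[ℂ] V}
    (h : ∀ ρ, IsDensity ρ → f ρ = g ρ) : f = g := by
  have hv : ∀ x : n → ℂ, f (Matrix.vecMulVec x (star x)) = g (Matrix.vecMulVec x (star x)) := by
    intro x
    by_cases hx : x = 0
    · simp [hx]
    · have hpos : (0 : ℝ) < ∑ i, ‖x i‖ ^ 2 := by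
        obtain ⟨i, hi⟩ : ∃ i, x i ≠ 0 := by
          by_contra hh; push Not at hh; exact hx (funext hh)
        exact Finset.sum_pos' (fun _ _ => by positivity) ⟨i, Finset.mem_univ _, by positivity⟩
      set r : ℝ := ∑ i, ‖x i‖ ^ 2
      have hxx : x ⬝ᵥ star x = (r : ℂ) := by
        simp [dotProduct, r, Complex.mul_conj, Complex.normSq_eq_norm_sq]
      have hsq : (Real.sqrt r : ℂ) * (Real.sqrt r : ℂ) = r := by
        rw [← Complex.ofReal_mul, Real.mul_self_sqrt hpos.le]
      have hr0 : (r : ℂ) ≠ 0 := by exact_mod_cast hpos.ne'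
      have hs0 : (Real.sqrt r : ℂ) ≠ 0 := by
        intro h0; rw [h0, zero_mul] at hsq; exact hr0 hsq.symm
      set y : n → ℂ := ((Real.sqrt r : ℂ)⁻¹) • x
      have hy : star y = ((Real.sqrt r : ℂ)⁻¹) • star x := by
        simp [y, star_smul]
      have hd := h _ (isDensity_vecMulVec y (by
        rw [hy, smul_dotProduct, dotProduct_smul, hxx, ← hsq]
        simp only [smul_eq_mul]; field_simp))
      have hxy : Matrix.vecMulVec x (star x) = (r : ℂ) • Matrix.vecMulVec y (star y) := by
        rw [hy, Matrix.smul_vecMulVec, Matrix.vecMulVec_smul, smul_smul, smul_smul, ← hsq]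
        have : (Real.sqrt r : ℂ) * (Real.sqrt r : ℂ) * (Real.sqrt r : ℂ)⁻¹ *
          (Real.sqrt r : ℂ)⁻¹ = 1 := by field_simp
        rw [this, one_smul]
      rw [hxy, map_smul, map_smul, hd]
  rw [← sub_eq_zero]
  set φ := f - g
  have hφ : ∀ x : n → ℂ, φ (Matrix.vecMulVec x (star x)) = 0 := fun x => by simp [φ, hv x]
  apply LinearMap.ext
  intro X
  suffices hs : ∀ i j, φ (Matrix.single i j 1) = 0 by
    have hX : ∀ i j, Matrix.single i j (X i j) = X i j • Matrix.single i j (1 : ℂ) := by simp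
    rw [Matrix.matrix_eq_sum_single X]
    simp only [map_sum, LinearMap.zero_apply, hX, map_smul, hs, smul_zero, Finset.sum_const_zero]
  intro i j
  have key : ∀ c : ℂ, φ (star c • Matrix.single i j 1 + c • Matrix.single j i 1) = 0 := by
    intro c
    have h1 := hφ (Pi.single i 1 + c • Pi.single j 1)
    have h2 := hφ (Pi.single i 1)
    have h3 := hφ (Pi.single j 1)
    have hst : ∀ k : n, star (Pi.single k (1 : ℂ) : n → ℂ) = Pi.single k 1 := by
      intro k; simp [Pi.star_single]
    rw [star_add, star_smul, hst, hst, Matrix.add_vecMulVec, Matrix.vecMulVec_add,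
      Matrix.vecMulVec_add] at h1
    rw [hst] at h2 h3
    simp only [Matrix.smul_vecMulVec, Matrix.vecMulVec_smul, map_add, map_smul, h2, h3,
      smul_zero, add_zero, zero_add] at h1
    simp only [← Matrix.single_eq_single_vecMulVec_single] at h1
    simpa only [map_add, map_smul] using h1
  -- With `E = |i⟩⟨j|`, the choices `c = 1` and `c = I` control the sum and the difference of `φ E`
  -- and `φ Eᴴ`, hence `φ E` itself.
  have k1 := key 1
  have kI := key Complex.I
  simp only [map_add, map_smul, star_one, one_smul] at k1 kI
  have e1 : φ (Matrix.single j i 1) = - φ (Matrix.single i j 1) :=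
    (neg_eq_of_add_eq_zero_right k1).symm
  rw [e1] at kI
  have : (-2 * Complex.I) • φ (Matrix.single i j 1) = 0 := by
    rw [← kI]
    simp only [Complex.star_def, Complex.conj_I]
    module
  exact (smul_eq_zero.1 this).resolve_left (by simp)

theorem IsChannel.trace_apply {a b : Type} [Fintype a] [DecidableEq a] [Fintype b]
    {Φ : Matrix a a ℂ →ₗ[ℂ] Matrix b b ℂ} (h : IsChannel Φ) (X : Matrix a a ℂ) :
    (Φ X).trace = X.trace := by
  obtain ⟨E, _, K, hK, hΦ⟩ := h
  rw [hΦ, Matrix.trace_sum]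
  have : ∀ e, (K e * X * (K e)ᴴ).trace = ((K e)ᴴ * K e * X).trace := fun e =>
    Matrix.trace_mul_cycle _ _ _
  simp only [this]
  rw [← Matrix.trace_sum, ← Matrix.sum_mul, hK, Matrix.one_mul]

/-! ### Recovery and secrecy -/

namespace Encoding

variable {d : ℕ} {ι : Type} [Fintype ι] [DecidableEq ι] {δ : ι → ℕ}

theorem recovers_iff (T : Encoding d ι δ) (A : Finset ι) :
    T.Recovers A ↔ ∃ R, IsChannel R ∧ R ∘ₗ reduceMap δ A ∘ₗ T.enc = LinearMap.id := by
  refine exists_congr fun R => and_congr_right fun _ => ⟨fun h => ?_, fun h ρ _ => ?_⟩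
  · refine linearMap_ext_isDensity fun ρ hρ => ?_
    simpa [reduce_eq_reduceMap] using h ρ hρ
  · rw [reduce_eq_reduceMap]
    exact LinearMap.congr_fun h ρ

theorem noInfo_iff (T : Encoding d ι δ) (A : Finset ι) :
    T.NoInfo A ↔ ∃ σ, ∀ X, reduceMap δ A (T.enc X) = X.trace • σ := by
  refine exists_congr fun σ => ⟨fun h X => ?_, fun h ρ hρ => ?_⟩
  · have : reduceMap δ A ∘ₗ T.enc = (Matrix.traceLinearMap (Fin d) ℂ ℂ).smulRight σ := by
      refine linearMap_ext_isDensity fun ρ hρ => ?_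
      simpa [reduce_eq_reduceMap, hρ.2] using h ρ hρ
    exact LinearMap.congr_fun this X
  · rw [reduce_eq_reduceMap, h, hρ.2, one_smul]

/-- Trace out the shares of `B` outside `A`, then apply the recovery for `A`. -/
theorem Recovers.mono {T : Encoding d ι δ} {A B : Finset ι} (h : T.Recovers A) (hAB : A ⊆ B) :
    T.Recovers B := by
  rw [recovers_iff] at h ⊢
  obtain ⟨R, hR, h⟩ := h
  refine ⟨R ∘ₗ labelMap (fun x (s : {s // s ∈ A}) => x ⟨s.1, hAB s.2⟩)
    (fun x (s : {s : {s // s ∈ B} // s.1 ∉ A}) => x s.1), hR.comp ?_, ?_⟩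
  · refine labelMap_isChannel _ _ fun x y h1 h2 => funext fun s => ?_
    by_cases hs : s.1 ∈ A
    · exact congrFun h1 ⟨s.1, hs⟩
    · exact congrFun h2 ⟨s, hs⟩
  · rw [LinearMap.comp_assoc, ← LinearMap.comp_assoc T.enc, reduceMap, labelMap_comp, ← h,
      reduceMap]
    congr 2
    refine labelMap_congr (fun x => rfl) fun x y => ?_
    simp only [Prod.mk.injEq, funext_iff, Subtype.forall]
    refine ⟨fun hh s hs => ?_, fun hh => ⟨fun s _ hs => hh s hs, fun s hs => hh s fun h' => hs (hAB h')⟩⟩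
    by_cases hB : s ∈ B
    · exact hh.1 s hB hs
    · exact hh.2 s hB

theorem isDensity_single {n : Type} [Fintype n] [DecidableEq n] (i : n) :
    IsDensity (Matrix.single i i (1 : ℂ)) := by
  have := isDensity_vecMulVec (Pi.single i (1 : ℂ)) (by simp [Pi.star_single])
  rwa [Pi.star_single, star_one, ← Matrix.single_eq_single_vecMulVec_single] at this

theorem not_recovers_of_noInfo (hd : 2 ≤ d) {T : Encoding d ι δ} {A : Finset ι}
    (h : T.NoInfo A) : ¬ T.Recovers A := by
  rintro ⟨R, _, hR⟩
  obtain ⟨σ, hσ⟩ := h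
  have key : ∀ i : Fin d, R σ = Matrix.single i i 1 := fun i => by
    rw [← hσ _ (isDensity_single i), hR _ (isDensity_single i)]
  have h01 := congrFun (congrFun ((key ⟨0, by omega⟩).symm.trans (key ⟨1, by omega⟩))
    ⟨0, by omega⟩) ⟨0, by omega⟩
  simp at h01

end Encoding

/-! ### Encodings by cosets of an additive code -/

section Code
open Classical

/-- The operation that adjoins to a system a uniform superposition of basis states. -/
noncomputable def adjoinUniform (a w : Type) [Fintype w] :
    Matrix a a ℂ →ₗ[ℂ] Matrix (a × w) (a × w) ℂ where
  toFun X := Matrix.of fun p r => (Fintype.card w : ℂ)⁻¹ * X p.1 r.1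
  map_add' X Y := by ext; simp [mul_add]
  map_smul' c X := by ext; simp [mul_left_comm]

theorem adjoinUniform_isChannel (a w : Type) [Fintype a] [DecidableEq a] [Fintype w]
    [Nonempty w] : IsChannel (adjoinUniform a w) := by
  have hc : (0 : ℝ) < Fintype.card w := by exact_mod_cast Fintype.card_pos
  have hs : ((Real.sqrt (Fintype.card w) : ℂ))⁻¹ * (Real.sqrt (Fintype.card w) : ℂ)⁻¹ =
      (Fintype.card w : ℂ)⁻¹ := by
    rw [← mul_inv, ← Complex.ofReal_mul, Real.mul_self_sqrt hc.le]; simp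
  have hc' : (Fintype.card w : ℂ) ≠ 0 := by exact_mod_cast hc.ne'
  refine ⟨Unit, inferInstance, fun _ => Matrix.of fun p s =>
    if p.1 = s then (Real.sqrt (Fintype.card w) : ℂ)⁻¹ else 0, ?_, fun ρ => ?_⟩
  · ext s t
    simp only [Matrix.mul_apply, Finset.univ_unique, Finset.sum_const, Finset.card_singleton,
      one_smul, Matrix.conjTranspose_apply, Matrix.of_apply, Fintype.sum_prod_type,
      apply_ite star, star_zero, ite_mul, zero_mul, mul_ite, mul_zero, star_inv₀,
      Complex.star_def, Complex.conj_ofReal, hs]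
    by_cases h : s = t
    · subst h
      simp [hc']
    · rw [Matrix.one_apply_ne h]
      refine Finset.sum_eq_zero fun x _ => ?_
      by_cases h1 : x = s <;> by_cases h2 : x = t <;> simp_all
  · ext p r
    simp only [Matrix.mul_apply, Finset.univ_unique, Finset.sum_const, Finset.card_singleton,
      one_smul, Matrix.conjTranspose_apply, Matrix.of_apply, apply_ite star, star_zero, ite_mul,
      zero_mul, mul_ite, mul_zero, star_inv₀, Complex.star_def, Complex.conj_ofReal]
    simp only [Finset.sum_ite_eq, Finset.mem_univ, if_true]
    simp only [adjoinUniform, LinearMap.coe_mk, AddHom.coe_mk, Matrix.of_apply, ← hs]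
    ring

theorem labelMap_adjoinUniform {a w : Type} [Fintype a] [Fintype w] [Nonempty w] :
    labelMap Prod.fst Prod.snd ∘ₗ adjoinUniform a w = LinearMap.id := by
  apply LinearMap.ext
  intro X
  ext i j
  have hc' : (Fintype.card w : ℂ) ≠ 0 := by exact_mod_cast Fintype.card_ne_zero
  simp only [LinearMap.comp_apply, labelMap_apply, adjoinUniform, LinearMap.coe_mk,
    AddHom.coe_mk, Matrix.of_apply, Fintype.sum_prod_type, LinearMap.id_apply]
  rw [Finset.sum_eq_single i]
  · have : ∀ z : w, (∑ y, ∑ z', if True ∧ y = j ∧ z = z' then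
        (Fintype.card w : ℂ)⁻¹ * X i y else 0) = (Fintype.card w : ℂ)⁻¹ * X i j := by
      intro z
      rw [Finset.sum_eq_single j]
      · simp
      · intro y _ hy; simp [hy]
      · simp
    simp only [this]
    simp [hc']
  · intro x _ hx
    simp [hx]
  · simp

/-- The discarded label reveals the secret, which kills the coherences between different secrets,
and the kept label does not involve it; only the trace of `X` survives. -/
theorem labelMap_adjoinUniform_trace {a w b e : Type} [Fintype a] [Fintype w] (f : a × w → b)
    (g : a × w → e) (f' : w → b) (r : w → w → Prop) (hf : ∀ p, f p = f' p.2)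
    (hg : ∀ p p', g p = g p' ↔ p.1 = p'.1 ∧ r p.2 p'.2) :
    ∃ σ, ∀ X, labelMap f g (adjoinUniform a w X) = X.trace • σ := by
  refine ⟨Matrix.of fun i j => ∑ z, ∑ z', if f' z = i ∧ f' z' = j ∧ r z z' then
    (Fintype.card w : ℂ)⁻¹ else 0, fun X => ?_⟩
  ext i j
  simp only [labelMap_apply, adjoinUniform, LinearMap.coe_mk, hf, hg,
    AddHom.coe_mk, Matrix.of_apply, Fintype.sum_prod_type, Matrix.smul_apply, smul_eq_mul,
    Matrix.trace, Matrix.diag_apply]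
  rw [Finset.sum_mul]
  refine Finset.sum_congr rfl fun s _ => ?_
  rw [Finset.mul_sum]
  refine Finset.sum_congr rfl fun z _ => ?_
  rw [Finset.sum_eq_single s, Finset.mul_sum]
  · refine Finset.sum_congr rfl fun z' _ => ?_
    simp only [true_and, mul_ite, mul_zero, mul_comm]
  · intro t _ ht
    simp [Ne.symm ht]
  · simp

variable {d q : ℕ} [NeZero q] {ι E : Type} [Fintype ι] [DecidableEq ι] [Fintype E]
  [DecidableEq E]

/-- The encoding of `|s⟩` by the uniform superposition over the coset `W + v s` of an additive
code, where the coordinates in `E` are discarded. -/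
noncomputable def codeEncoding (W : AddSubgroup (ι ⊕ E → Fin q)) (v : Fin d → ι ⊕ E → Fin q)
    (hv : ∀ s t, v s - v t ∈ W → s = t) : Encoding d ι (fun _ => q) where
  enc := labelMap (fun (p : Fin d × W) i => p.2.1 (Sum.inl i) + v p.1 (Sum.inl i))
    (fun p e => p.2.1 (Sum.inr e) + v p.1 (Sum.inr e)) ∘ₗ adjoinUniform (Fin d) W
  isChannel := by
    refine (labelMap_isChannel _ _ ?_).comp (adjoinUniform_isChannel _ _)
    rintro ⟨s, w⟩ ⟨t, z⟩ h1 h2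
    have h : w.1 + v s = z.1 + v t := by
      ext i
      rcases i with i | i
      · exact congrArg Fin.val (congrFun h1 i)
      · exact congrArg Fin.val (congrFun h2 i)
    have hst : s = t := by
      refine hv s t ?_
      have : v s - v t = z.1 - w.1 := by
        rw [sub_eq_sub_iff_add_eq_add, add_comm, h, add_comm]
      rw [this]
      exact W.sub_mem z.2 w.2
    subst hst
    simp only [Prod.mk.injEq, true_and]
    exact Subtype.ext (add_right_cancel h)

theorem codeEncoding_eq_of_sub_mem (W : AddSubgroup (ι ⊕ E → Fin q))
    {v v' : Fin d → ι ⊕ E → Fin q} (hv : ∀ s t, v s - v t ∈ W → s = t)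
    (hv' : ∀ s t, v' s - v' t ∈ W → s = t) (h : ∀ s, v' s - v s ∈ W) :
    codeEncoding W v hv = codeEncoding W v' hv' := by
  unfold codeEncoding
  congr 1
  apply LinearMap.ext
  intro X
  -- For each `s`, translation by `v' s - v s` permutes `W` and fixes its uniform superposition.
  let σ : Fin d × W ≃ Fin d × W :=
    { toFun := fun p => (p.1, p.2 + ⟨_, h p.1⟩)
      invFun := fun p => (p.1, p.2 - ⟨_, h p.1⟩)
      left_inv := fun p => by simp
      right_inv := fun p => by simp }
  rw [LinearMap.comp_apply, labelMap_reindex σ, LinearMap.comp_apply]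
  have h1 : (adjoinUniform (Fin d) W X).submatrix σ σ = adjoinUniform (Fin d) W X := rfl
  rw [h1, labelMap_congr (fun p => ?_) (fun p r => ?_)]
  · funext i
    simp [σ, add_assoc]
  · refine Eq.congr ?_ ?_ <;>
    · funext i
      simp [σ, add_assoc]

theorem reduceMap_comp_codeEncoding (W : AddSubgroup (ι ⊕ E → Fin q))
    {v : Fin d → ι ⊕ E → Fin q} (hv : ∀ s t, v s - v t ∈ W → s = t) (A : Finset ι) :
    reduceMap (fun _ => q) A ∘ₗ (codeEncoding W v hv).enc =
      labelMap (fun (p : Fin d × W) (i : {i // i ∈ A}) =>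
          p.2.1 (Sum.inl i.1) + v p.1 (Sum.inl i.1))
        (fun p => (fun (i : {i // i ∉ A}) => p.2.1 (Sum.inl i.1) + v p.1 (Sum.inl i.1),
          fun e => p.2.1 (Sum.inr e) + v p.1 (Sum.inr e))) ∘ₗ adjoinUniform (Fin d) W := by
  rw [codeEncoding, reduceMap, ← LinearMap.comp_assoc, labelMap_comp]
  rfl

theorem codeEncoding_recovers [NeZero d] (W : AddSubgroup (ι ⊕ E → Fin q))
    {v : Fin d → ι ⊕ E → Fin q} (hv : ∀ s t, v s - v t ∈ W → s = t) (A : Finset ι)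
    (hdec : ∀ s t, ∀ w ∈ W,
      (∀ i ∈ A, w (Sum.inl i) + v s (Sum.inl i) = v t (Sum.inl i)) → s = t)
    (v' : Fin d → ι ⊕ E → Fin q) (h : ∀ s, v' s - v s ∈ W)
    (h0 : ∀ s, ∀ i ∉ A, v' s (Sum.inl i) = 0) (h0' : ∀ s e, v' s (Sum.inr e) = 0) :
    (codeEncoding W v hv).Recovers A := by
  have hdec' : ∀ s t, ∀ w ∈ W,
      (∀ i ∈ A, w (Sum.inl i) + v' s (Sum.inl i) = v' t (Sum.inl i)) → s = t := by
    intro s t w hw hh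
    refine hdec s t (w + (v' s - v s) - (v' t - v t))
      (W.sub_mem (W.add_mem hw (h s)) (h t)) fun i hi => ?_
    have := hh i hi
    simp only [Pi.add_apply, Pi.sub_apply]
    rw [← this]; abel
  have hv' : ∀ s t, v' s - v' t ∈ W → s = t := fun s t hst => by
    refine hdec' s t (v' t - v' s) (by simpa using W.neg_mem hst) fun i _ => by simp
  rw [codeEncoding_eq_of_sub_mem W hv hv' h, Encoding.recovers_iff,
    reduceMap_comp_codeEncoding]
  -- The decoder on the labels of `A`; the value `0` on labels that never occur is arbitrary.
  have hex : ∃ f : ({i // i ∈ A} → Fin q) → Fin d, ∀ p : Fin d × W,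
      f (fun i => p.2.1 (Sum.inl i.1) + v' p.1 (Sum.inl i.1)) = p.1 := by
    refine ⟨fun x => if hx : ∃ p : Fin d × W,
      (fun i : {i // i ∈ A} => p.2.1 (Sum.inl i.1) + v' p.1 (Sum.inl i.1)) = x then
      hx.choose.1 else 0, fun p => ?_⟩
    have hx : ∃ p' : Fin d × W,
      (fun i : {i // i ∈ A} => p'.2.1 (Sum.inl i.1) + v' p'.1 (Sum.inl i.1)) =
        (fun i : {i // i ∈ A} => p.2.1 (Sum.inl i.1) + v' p.1 (Sum.inl i.1)) := ⟨p, rfl⟩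
    simp only [dif_pos hx]
    refine hdec' _ _ (hx.choose.2.1 - p.2.1) (W.sub_mem hx.choose.2.2 p.2.2) fun i hi => ?_
    have := congrFun hx.choose_spec ⟨i, hi⟩
    simp only at this
    rw [Pi.sub_apply, sub_add_eq_add_sub, this]; abel
  obtain ⟨f, hf⟩ := hex
  -- Once `s` is read off, subtracting `v' s` leaves the bare `w` on `A`. As `v'` vanishes
  -- elsewhere, the environment holds exactly `w`, uncorrelated with the secret.
  refine ⟨labelMap f (fun x i => x i - v' (f x) (Sum.inl i.1)),
    labelMap_isChannel _ _ fun x y h1 h2 => ?_, ?_⟩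
  · funext i
    have := congrFun h2 i
    simpa [h1] using this
  · rw [← LinearMap.comp_assoc, labelMap_comp, ← labelMap_adjoinUniform (w := W)]
    congr 1
    refine labelMap_congr hf fun p r => ?_
    simp only [hf, add_sub_cancel_right, h0', add_zero, Prod.mk.injEq, funext_iff,
      Subtype.forall]
    constructor
    · rintro ⟨h1, h2, h3⟩
      refine Subtype.ext (funext fun i => ?_)
      rcases i with i | i
      · by_cases hi : i ∈ A
        · exact h1 i hi
        · simpa [h0 _ i hi] using h2 i hi
      · exact h3 i
    · intro hh
      refine ⟨fun i _ => by rw [hh], fun i hi => by rw [hh, h0 _ i hi, h0 _ i hi],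
        fun i => by rw [hh]⟩

theorem codeEncoding_noInfo (W : AddSubgroup (ι ⊕ E → Fin q))
    {v : Fin d → ι ⊕ E → Fin q} (hv : ∀ s t, v s - v t ∈ W → s = t) (B : Finset ι)
    (hdec : ∀ s t, ∀ w ∈ W,
      (∀ i ∉ B, w (Sum.inl i) + v s (Sum.inl i) = v t (Sum.inl i)) →
      (∀ e, w (Sum.inr e) + v s (Sum.inr e) = v t (Sum.inr e)) → s = t)
    (v' : Fin d → ι ⊕ E → Fin q) (h : ∀ s, v' s - v s ∈ W)
    (h0 : ∀ s, ∀ i ∈ B, v' s (Sum.inl i) = 0) :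
    (codeEncoding W v hv).NoInfo B := by
  have hdec' : ∀ s t, ∀ w ∈ W,
      (∀ i ∉ B, w (Sum.inl i) + v' s (Sum.inl i) = v' t (Sum.inl i)) →
      (∀ e, w (Sum.inr e) + v' s (Sum.inr e) = v' t (Sum.inr e)) → s = t := by
    intro s t w hw hh hh'
    refine hdec s t (w + (v' s - v s) - (v' t - v t))
      (W.sub_mem (W.add_mem hw (h s)) (h t)) (fun i hi => ?_) (fun i => ?_)
    · have := hh i hi
      simp only [Pi.add_apply, Pi.sub_apply]
      rw [← this]; abel
    · have := hh' i
      simp only [Pi.add_apply, Pi.sub_apply]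
      rw [← this]; abel
  have hv' : ∀ s t, v' s - v' t ∈ W → s = t := fun s t hst => by
    refine hdec' s t (v' t - v' s) (by simpa using W.neg_mem hst) (fun i _ => by simp)
      (fun i => by simp)
  rw [codeEncoding_eq_of_sub_mem W hv hv' h, Encoding.noInfo_iff]
  have := reduceMap_comp_codeEncoding W hv' B
  simp only [LinearMap.ext_iff, LinearMap.comp_apply] at this
  simp only [this]
  refine labelMap_adjoinUniform_trace _ _ (fun w (i : {i // i ∈ B}) => w.1 (Sum.inl i.1))
    (fun w z => (∀ i ∉ B, w.1 (Sum.inl i) = z.1 (Sum.inl i)) ∧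
      ∀ e, w.1 (Sum.inr e) = z.1 (Sum.inr e)) (fun p => ?_) (fun p r => ?_)
  · funext i
    rw [h0 _ _ i.2, add_zero]
  · simp only [Prod.mk.injEq, funext_iff, Subtype.forall]
    constructor
    · rintro ⟨h1, h2⟩
      -- The discarded coordinates determine the secret, so agreement on them forces equal secrets.
      have hpr : p.1 = r.1 := by
        refine hdec' _ _ (p.2.1 - r.2.1) (W.sub_mem p.2.2 r.2.2) (fun i hi => ?_) (fun i => ?_)
        · rw [Pi.sub_apply, sub_add_eq_add_sub, h1 i hi]; abel
        · rw [Pi.sub_apply, sub_add_eq_add_sub, h2 i]; abel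
      refine ⟨hpr, fun i hi => ?_, fun i => ?_⟩
      · simpa [hpr] using h1 i hi
      · simpa [hpr] using h2 i
    · rintro ⟨hpr, h1, h2⟩
      exact ⟨fun i hi => by rw [hpr, h1 i hi], fun i => by rw [hpr, h2 i]⟩

end Code

/-! ### Threshold schemes from polynomial codes -/

section Threshold
open Polynomial

theorem exists_isThreshold {d q k : ℕ} {ι : Type} [Fintype ι] [DecidableEq ι] (hd : 0 < d)
    (hq : q.Prime) (hdq : d ≤ q) (hk : 0 < k) (hι : Fintype.card ι = 2 * k - 1)
    (hkq : 2 * k - 1 ≤ q) : ∃ T : Encoding d ι (fun _ => q), T.IsThreshold k (2 * k - 1) := by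
  have : Fact q.Prime := ⟨hq⟩
  have : NeZero d := ⟨hd.ne'⟩
  -- Distinct evaluation points suffice, and `0` is allowed, because the secret sits in the leading
  -- coefficient; hence `q ≥ 2k - 1` is enough.
  obtain ⟨a⟩ : Nonempty (ι ↪ ZMod q) := by
    rw [Function.Embedding.nonempty_iff_card_le, hι, ZMod.card]; exact hkq
  let e := ZMod.finEquiv q
  let sec : Fin d → ZMod q := fun s => ((s : ℕ) : ZMod q)
  have hsec : ∀ s t, sec s = sec t → s = t := by
    intro s t h
    have := (ZMod.natCast_eq_natCast_iff' _ _ _).1 h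
    rw [Nat.mod_eq_of_lt (by omega), Nat.mod_eq_of_lt (by omega)] at this
    exact Fin.ext this
  let W : AddSubgroup (ι ⊕ Empty → Fin q) :=
    { carrier := {w | ∃ p : (ZMod q)[X], p.degree < ((k - 1 : ℕ) : WithBot ℕ) ∧
        ∀ i, e (w (Sum.inl i)) = p.eval (a i)}
      zero_mem' := ⟨0, by simp, fun i => by simp⟩
      add_mem' := by
        rintro w z ⟨p, hp, hw⟩ ⟨r, hr, hz⟩
        exact ⟨p + r, (degree_add_le _ _).trans_lt (max_lt hp hr), fun i => by
          simp [hw, hz]⟩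
      neg_mem' := by
        rintro w ⟨p, hp, hw⟩
        exact ⟨-p, by rwa [degree_neg], fun i => by simp [hw]⟩ }
  let v : Fin d → ι ⊕ Empty → Fin q := fun s =>
    Sum.elim (fun i => e.symm (sec s * a i ^ (k - 1))) (fun _ => 0)
  -- A polynomial of degree at most `k - 1` with `k` zeros vanishes, so `k` values fix the
  -- coefficient of `X ^ (k - 1)`.
  have dec : ∀ B : Finset ι, k ≤ B.card → ∀ s t, ∀ w ∈ W,
      (∀ i ∈ B, w (Sum.inl i) + v s (Sum.inl i) = v t (Sum.inl i)) → s = t := by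
    rintro B hB s t w ⟨p, hp, hw⟩ h
    set P := p + C (sec s - sec t) * X ^ (k - 1)
    have hP : P = 0 := by
      refine eq_zero_of_degree_lt_of_eval_finset_eq_zero (B.map a) ?_ ?_
      · rw [Finset.card_map]
        refine (degree_add_le _ _).trans_lt (max_lt (hp.trans ?_)
          ((degree_C_mul_X_pow_le _ _).trans_lt ?_)) <;>
        · exact_mod_cast (by omega : k - 1 < B.card)
      · intro x hx
        obtain ⟨i, hi, rfl⟩ := Finset.mem_map.1 hx
        have := congrArg e (h i hi)
        simp only [v, map_add, hw, Sum.elim_inl, RingEquiv.apply_symm_apply] at this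
        simp only [P, eval_add, eval_mul, eval_C, eval_pow, eval_X]
        linear_combination this
    have h1 := congrArg (fun r => r.coeff (k - 1)) hP
    simp only [P, coeff_add, coeff_C_mul, coeff_X_pow, if_true, mul_one, coeff_zero,
      coeff_eq_zero_of_degree_lt hp, zero_add] at h1
    exact hsec _ _ (sub_eq_zero.1 h1)
  have shift : ∀ Z : Finset ι, Z.card ≤ k - 1 → ∃ v' : Fin d → ι ⊕ Empty → Fin q,
      (∀ s, v' s - v s ∈ W) ∧ ∀ s, ∀ i ∈ Z, v' s (Sum.inl i) = 0 := by
    intro Z hZ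
    -- A monic polynomial vanishing on `Z`, padded by a power of `X` to degree exactly `k - 1`, so
    -- that it differs from `X ^ (k - 1)` by an element of lower degree.
    set m : (ZMod q)[X] := (∏ i ∈ Z, (X - C (a i))) * X ^ (k - 1 - Z.card)
    have hm1 : (∏ i ∈ Z, (X - C (a i))).Monic := monic_prod_of_monic _ _ fun i _ => monic_X_sub_C _
    have hm : m.Monic := hm1.mul (monic_X_pow _)
    have hdeg : m.natDegree = k - 1 := by
      rw [hm1.natDegree_mul (monic_X_pow _), natDegree_X_pow,
        natDegree_prod_of_monic _ _ fun i _ => monic_X_sub_C _]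
      simp only [natDegree_X_sub_C, Finset.sum_const, smul_eq_mul, mul_one]
      omega
    refine ⟨fun s => Sum.elim (fun i => e.symm (sec s * m.eval (a i))) (fun _ => 0),
      fun s => ⟨C (sec s) * (m - X ^ (k - 1)), ?_, fun i => ?_⟩, fun s i hi => ?_⟩
    · have h1 : m.degree = ((k - 1 : ℕ) : WithBot ℕ) := by
        rw [degree_eq_natDegree hm.ne_zero, hdeg]
      rw [C_mul', ← h1]
      refine (degree_smul_le _ _).trans_lt ?_
      exact degree_sub_lt_left (by rw [h1, degree_X_pow]) hm.ne_zero
        (by rw [hm.leadingCoeff, leadingCoeff_X_pow])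
    · simp [v, mul_sub]
    · have : m.eval (a i) = 0 := by
        simp only [m, eval_mul, eval_prod]
        rw [Finset.prod_eq_zero hi (by simp), zero_mul]
      simp [this]
  have hv : ∀ s t, v s - v t ∈ W → s = t := fun s t h =>
    dec Finset.univ (by rw [Finset.card_univ, hι]; omega) s t (v t - v s)
      (by simpa using W.neg_mem h) fun i _ => by simp
  refine ⟨codeEncoding W v hv, hι, fun A => ⟨fun hA => ?_, fun hA => ?_⟩⟩
  -- Among `2k - 1` shares, exactly one of `A` and its complement has at least `k`: that one
  -- decodes, and the other is small enough to be cleared.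
  · obtain ⟨v', h1, h2⟩ := shift Aᶜ (by rw [Finset.card_compl, hι]; omega)
    exact codeEncoding_recovers W hv A (dec A hA) v' h1
      (fun s i hi => h2 s i (Finset.mem_compl.2 hi)) fun s e => e.elim
  · obtain ⟨v', h1, h2⟩ := shift A (by omega)
    refine codeEncoding_noInfo W hv A (fun s t w hw h _ => ?_) v' h1 h2
    exact dec Aᶜ (by rw [Finset.card_compl, hι]; omega) s t w hw
      fun i hi => h i (Finset.mem_compl.1 hi)

end Threshold

/-! ### Conventional schemes for intersecting families -/

/-- The discarded environment acts as an extra player `none`. The array has a row and a column for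
every set `A` of players, and the holders of row `A` and column `A` all lie in `U A`: row `A`
determines the secret, and column `A` can carry the whole representative. Only addition is used, so
`q` need not be prime. -/
theorem exists_realizesConventionally {N q : ℕ} [NeZero q] (c : Finset (Finset (Fin N)))
    (hc : ∀ α ∈ c, ∀ β ∈ c, (α ∩ β).Nonempty) :
    ∃ S : SharingScheme N q, S.RealizesConventionally {A | ∃ B ∈ c, B ⊆ A} ∧
      ∀ s, S.dim s = q := by
  classical
  set Γ : Set (Finset (Fin N)) := {A | ∃ B ∈ c, B ⊆ A}
  -- The side that must be able to decode: `A` itself if authorized, otherwise its complement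
  -- together with the environment.
  let U : Finset (Fin N) → Finset (Option (Fin N)) := fun A =>
    if A ∈ Γ then A.map Function.Embedding.some else insert none (Aᶜ.map Function.Embedding.some)
  have hUpos : ∀ {A}, A ∈ Γ → ∀ {x}, x ∈ U A ↔ ∃ p ∈ A, some p = x := by
    intro A hA x; simp [U, hA]
  have hUneg : ∀ {A}, A ∉ Γ → ∀ {x}, x ∈ U A ↔ x = none ∨ ∃ p ∉ A, some p = x := by
    intro A hA x; simp [U, hA]
  -- Two authorized sets meet by `hc`; an authorized set is not contained in an unauthorized one;
  -- two complements share the environment.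
  have hU : ∀ A B, ∃ x, x ∈ U A ∧ x ∈ U B := by
    have mixed : ∀ A B, A ∈ Γ → B ∉ Γ → ∃ x, x ∈ U A ∧ x ∈ U B := by
      rintro A B ⟨α, hα, hαA⟩ hB
      obtain ⟨p, hp, hpB⟩ : ∃ p ∈ α, p ∉ B := by
        by_contra h; push Not at h; exact hB ⟨α, hα, h⟩
      exact ⟨some p, (hUpos ⟨α, hα, hαA⟩).2 ⟨p, hαA hp, rfl⟩,
        (hUneg hB).2 (Or.inr ⟨p, hpB, rfl⟩)⟩
    intro A B
    by_cases hA : A ∈ Γ <;> by_cases hB : B ∈ Γ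
    · obtain ⟨α, hα, hαA⟩ := id hA
      obtain ⟨β, hβ, hβB⟩ := id hB
      obtain ⟨p, hp⟩ := hc α hα β hβ
      rw [Finset.mem_inter] at hp
      exact ⟨some p, (hUpos hA).2 ⟨p, hαA hp.1, rfl⟩, (hUpos hB).2 ⟨p, hβB hp.2, rfl⟩⟩
    · exact mixed A B hA hB
    · obtain ⟨x, h1, h2⟩ := mixed B A hB hA
      exact ⟨x, h2, h1⟩
    · exact ⟨none, (hUneg hA).2 (Or.inl rfl), (hUneg hB).2 (Or.inl rfl)⟩
  choose h hl hr using hU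
  let Share := {p : Finset (Fin N) × Finset (Fin N) // h p.1 p.2 ≠ none}
  let Env := {p : Finset (Fin N) × Finset (Fin N) // ¬ h p.1 p.2 ≠ none}
  let pos : Share ⊕ Env → Finset (Fin N) × Finset (Fin N) := Sum.elim Subtype.val Subtype.val
  -- Arrays constant along each column whose column values sum to zero. The sum of the column values
  -- is the encoded secret.
  let W : AddSubgroup (Share ⊕ Env → Fin q) :=
    { carrier := {w | ∃ f : Finset (Fin N) → Fin q, ∑ j, f j = 0 ∧ ∀ k, w k = f (pos k).2}
      zero_mem' := ⟨0, by simp, fun k => rfl⟩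
      add_mem' := by
        rintro w z ⟨f, hf, hw⟩ ⟨g, hg, hz⟩
        exact ⟨f + g, by simp [Finset.sum_add_distrib, hf, hg], fun k => by simp [hw, hz]⟩
      neg_mem' := by
        rintro w ⟨f, hf, hw⟩
        exact ⟨-f, by simp [hf], fun k => by simp [hw]⟩ }
  -- The secret may be placed in any single column without changing the coset; column `∅` is an
  -- arbitrary reference.
  let col : Finset (Fin N) → Fin q → Share ⊕ Env → Fin q := fun A s k => if (pos k).2 = A then s else 0
  have hcol : ∀ A s, col A s - col ∅ s ∈ W := fun A s =>
    ⟨fun j => (if j = A then s else 0) - (if j = ∅ then s else 0), by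
      simp [Finset.sum_sub_distrib], fun k => rfl⟩
  have dec : ∀ (A : Finset (Fin N)) (s t : Fin q), ∀ w ∈ W,
      (∀ k, (pos k).1 = A → w k + col ∅ s k = col ∅ t k) → s = t := by
    rintro A s t w ⟨f, hf, hw⟩ hk
    have hj : ∀ j : Finset (Fin N), f j + (if j = ∅ then s else 0) = if j = ∅ then t else 0 := by
      intro j
      obtain ⟨k, hkj⟩ : ∃ k, pos k = (A, j) := by
        by_cases hh : h A j ≠ none
        · exact ⟨Sum.inl ⟨(A, j), hh⟩, rfl⟩
        · exact ⟨Sum.inr ⟨(A, j), hh⟩, rfl⟩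
      have := hk k (by rw [hkj])
      simpa only [hw, col, hkj] using this
    -- Row `A` shows every column value once; adding them up removes `f` and leaves `s = t`.
    have := Finset.sum_congr (rfl : (Finset.univ : Finset (Finset (Fin N))) = _) fun j _ => hj j
    simpa [Finset.sum_add_distrib, hf] using this
  have hv : ∀ s t, col ∅ s - col ∅ t ∈ W → s = t := fun s t hst =>
    dec ∅ s t (col ∅ t - col ∅ s) (by simpa using W.neg_mem hst) fun k _ => by simp
  let S : SharingScheme N q :=
    { Share := Share
      dim := fun _ => q
      holder := fun s => h s.1.1 s.1.2
      encoding := codeEncoding W (col ∅) hv }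
  have hres : ∀ s, S.holder s ≠ none := fun s => s.2
  have hav : ∀ A s, s ∈ S.available A ↔ ∃ p ∈ A, some p = S.holder s := by
    intro A s
    simp [SharingScheme.available, hres, eq_comm]
  refine ⟨S, ⟨fun A => ⟨fun hA => ?_, fun hA => ?_⟩, ?_⟩, fun s => rfl⟩
  · refine codeEncoding_recovers W hv (S.available A) (fun s t w hw hh => ?_) (col A) (hcol A)
      (fun s i hi => ?_) (fun s k => ?_)
    · refine dec A s t w hw ?_
      rintro (k | k) hk
      · refine hh k ((hav A k).2 ?_)
        subst hk
        exact (hUpos hA).1 (hl _ _)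
      · subst hk
        obtain ⟨p, _, hp⟩ := (hUpos hA).1 (hl _ k.1.2)
        exact absurd (not_not.1 k.2) (hp ▸ Option.some_ne_none p)
    · refine if_neg fun hj => hi ((hav A i).2 ?_)
      subst hj
      exact (hUpos hA).1 (hr _ _)
    · refine if_neg fun hj => ?_
      subst hj
      obtain ⟨p, _, hp⟩ := (hUpos hA).1 (hr k.1.1 _)
      exact absurd (not_not.1 k.2) (hp ▸ Option.some_ne_none p)
  · refine codeEncoding_noInfo W hv (S.available A) (fun s t w hw hh hh' => ?_) (col A) (hcol A)
      (fun s i hi => ?_)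
    · refine dec A s t w hw ?_
      rintro (k | k) hk
      · refine hh k fun hk' => ?_
        obtain ⟨p, hp, hpk⟩ := (hav A k).1 hk'
        subst hk
        have := (hUneg hA).1 (hl _ k.1.2)
        rcases this with h0 | ⟨p', hp', hpk'⟩
        · exact hres k h0
        · exact hp' (Option.some_injective _ (hpk'.trans hpk.symm) ▸ hp)
      · exact hh' k
    · refine if_neg fun hj => ?_
      obtain ⟨p, hp, hpk⟩ := (hav A i).1 hi
      subst hj
      have := (hUneg hA).1 (hr i.1.1 _)
      rcases this with h0 | ⟨p', hp', hpk'⟩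
      · exact hres i h0
      · exact hp' (Option.some_injective _ (hpk'.trans hpk.symm) ▸ hp)
  · exact Finset.filter_eq_empty_iff.2 fun s _ => hres s

/-! ### Tensor products of operations and concatenation -/

theorem linearMap_apply_eq_sum {a b : Type} [Fintype a] [DecidableEq a]
    (Φ : Matrix a a ℂ →ₗ[ℂ] Matrix b b ℂ) (X : Matrix a a ℂ) (x y : b) :
    Φ X x y = ∑ u, ∑ v, X u v * Φ (Matrix.single u v 1) x y := by
  have hX : ∀ i j, Matrix.single i j (X i j) = X i j • Matrix.single i j (1 : ℂ) := by simp
  conv_lhs => rw [Matrix.matrix_eq_sum_single X]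
  simp only [map_sum, hX, map_smul, Matrix.sum_apply, Matrix.smul_apply, smul_eq_mul]

theorem tensorMap_apply {J : Type} [Fintype J] [DecidableEq J] {a b : J → Type}
    [∀ j, Fintype (a j)] [∀ j, DecidableEq (a j)]
    (Φ : ∀ j, Matrix (a j) (a j) ℂ →ₗ[ℂ] Matrix (b j) (b j) ℂ)
    (X : Matrix (∀ j, a j) (∀ j, a j) ℂ) (x y : ∀ j, b j) : tensorMap Φ X x y =
      ∑ u, ∑ v, X u v * ∏ j, Φ j (Matrix.single (u j) (v j) 1) (x j) (y j) := rfl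

section TensorMap

variable {J : Type} [Fintype J] [DecidableEq J] {a b c : J → Type}
    [∀ j, Fintype (a j)] [∀ j, DecidableEq (a j)] [∀ j, Fintype (b j)] [∀ j, DecidableEq (b j)]

theorem tensorMap_comp (Ψ : ∀ j, Matrix (b j) (b j) ℂ →ₗ[ℂ] Matrix (c j) (c j) ℂ)
    (Φ : ∀ j, Matrix (a j) (a j) ℂ →ₗ[ℂ] Matrix (b j) (b j) ℂ) :
    tensorMap Ψ ∘ₗ tensorMap Φ = tensorMap fun j => Ψ j ∘ₗ Φ j := by
  apply LinearMap.ext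
  intro X
  ext x y
  have key : ∀ (p r : ∀ j, a j),
      ∏ j, Ψ j (Φ j (Matrix.single (p j) (r j) 1)) (x j) (y j) =
      ∑ u : ∀ j, b j, ∑ v : ∀ j, b j, (∏ j, Φ j (Matrix.single (p j) (r j) 1) (u j) (v j)) *
        ∏ j, Ψ j (Matrix.single (u j) (v j) 1) (x j) (y j) := by
    intro p r
    have : ∀ j, Ψ j (Φ j (Matrix.single (p j) (r j) 1)) (x j) (y j) =
      ∑ u, ∑ v, Φ j (Matrix.single (p j) (r j) 1) u v * Ψ j (Matrix.single u v 1) (x j) (y j) :=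
      fun j => linearMap_apply_eq_sum _ _ _ _
    simp only [this, Fintype.prod_sum, Finset.prod_mul_distrib]
  simp only [LinearMap.comp_apply, tensorMap_apply, key, Finset.mul_sum, Finset.sum_mul]
  simp only [Finset.sum_comm (s := (Finset.univ : Finset (∀ j, b j)))
    (t := (Finset.univ : Finset (∀ j, a j))), mul_assoc]

end TensorMap

theorem prod_ite_one_eq {J : Type} [Fintype J] {n : J → Type} [∀ j, DecidableEq (n j)] (u v : ∀ j, n j) :
    ∏ j, (if u j = v j then (1 : ℂ) else 0) = if u = v then 1 else 0 := by
  rw [Finset.prod_ite_zero]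
  simp [funext_iff]

theorem prod_eq_prod_mem_mul_prod_notMem {J : Type} [Fintype J] [DecidableEq J] (K : Finset J)
    (f : J → ℂ) : ∏ j, f j = (∏ j : {j // j ∈ K}, f j) * ∏ j : {j // j ∉ K}, f j := by
  rw [← Fintype.prod_subtype_mul_prod_subtype (fun j => j ∈ K)]
  congr 1
  exact Finset.prod_congr (by ext; simp) fun _ _ => rfl

theorem mul_ite_one_zero_mul (p r s : Prop) [Decidable p] [Decidable r] [Decidable s]
    [Decidable (p ∧ r ∧ s)] (c : ℂ) :
    c * ((if p then 1 else 0) * (if r then 1 else 0) * (if s then 1 else 0)) =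
      if p ∧ r ∧ s then c else 0 := by
  by_cases hp : p <;> by_cases hr : r <;> by_cases hs : s <;> simp [hp, hr, hs]

section Concat

variable {J : Type} [Fintype J] [DecidableEq J] {Sh : J → Type} [∀ j, Fintype (Sh j)]
  [∀ j, DecidableEq (Sh j)]

/-- Joint basis labels of the shares `⟨j, s⟩` with `s ∈ A j`, grouped by `j`. -/
def sigmaLabelEquiv (dim : ∀ j, Sh j → ℕ) (A : ∀ j, Finset (Sh j)) :
    (∀ s : {s : Σ j, Sh j // s ∈ Finset.univ.sigma A}, Fin (dim s.1.1 s.1.2)) ≃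
      ∀ j, ∀ s : {s // s ∈ A j}, Fin (dim j s.1) where
  toFun x j s := x ⟨⟨j, s.1⟩, Finset.mem_sigma.2 ⟨Finset.mem_univ _, s.2⟩⟩
  invFun y s := y s.1.1 ⟨s.1.2, (Finset.mem_sigma.1 s.2).2⟩
  left_inv _ := rfl
  right_inv _ := rfl

/-- Joint basis labels of the shares `⟨j, s⟩` with `s ∉ A j`, grouped by `j`. -/
def sigmaComplLabelEquiv (dim : ∀ j, Sh j → ℕ) (A : ∀ j, Finset (Sh j)) :
    (∀ s : {s : Σ j, Sh j // s ∉ Finset.univ.sigma A}, Fin (dim s.1.1 s.1.2)) ≃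
      ∀ j, ∀ s : {s // s ∉ A j}, Fin (dim j s.1) where
  toFun x j s := x ⟨⟨j, s.1⟩, fun h => s.2 (Finset.mem_sigma.1 h).2⟩
  invFun y s := y s.1.1 ⟨s.1.2, fun h => s.2 (Finset.mem_sigma.2 ⟨Finset.mem_univ _, h⟩)⟩
  left_inv _ := rfl
  right_inv _ := rfl

/-- The basis labels of the discarded shares also group by `j`, so the partial trace of a tensor
product factors. -/
theorem reduceMap_sigma {a : J → Type} [∀ j, Fintype (a j)] [∀ j, DecidableEq (a j)]
    (dim : ∀ j, Sh j → ℕ) (A : ∀ j, Finset (Sh j))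
    (Ψ : ∀ j, Matrix (a j) (a j) ℂ →ₗ[ℂ]
      Matrix (∀ s, Fin (dim j s)) (∀ s, Fin (dim j s)) ℂ) :
    reduceMap (fun s : Σ j, Sh j => dim s.1 s.2) (Finset.univ.sigma A) ∘ₗ
      relabel (Equiv.piCurry fun j (s : Sh j) => Fin (dim j s)).symm ∘ₗ tensorMap Ψ =
    relabel (sigmaLabelEquiv dim A).symm ∘ₗ
      tensorMap fun j => reduceMap (dim j) (A j) ∘ₗ Ψ j := by
  apply LinearMap.ext
  intro X
  ext x y
  simp only [LinearMap.comp_apply, ← reduce_eq_reduceMap, relabel, LinearEquiv.coe_coe,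
    Matrix.coe_reindexLinearEquiv, Matrix.reindex_apply, Matrix.submatrix_apply,
    Equiv.symm_symm, reduce, Matrix.of_apply, tensorMap_apply]
  simp only [Fintype.prod_sum]
  have key : ∀ (u : ∀ s : {s : Σ j, Sh j // s ∈ Finset.univ.sigma A}, Fin (dim s.1.1 s.1.2))
      (z : ∀ s : {s : Σ j, Sh j // s ∉ Finset.univ.sigma A}, Fin (dim s.1.1 s.1.2)) (j : J),
      (Equiv.piCurry fun j (s : Sh j) => Fin (dim j s))
        ((Equiv.piEquivPiSubtypeProd (fun s => s ∈ Finset.univ.sigma A)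
          fun s : Σ j, Sh j => Fin (dim s.1 s.2)).symm (u, z)) j =
      (Equiv.piEquivPiSubtypeProd (fun s => s ∈ A j) fun s => Fin (dim j s)).symm
        (sigmaLabelEquiv dim A u j, sigmaComplLabelEquiv dim A z j) := by
    intro u z j
    funext s
    by_cases hs : s ∈ A j
    · simp [Equiv.piCurry, Sigma.curry, hs, sigmaLabelEquiv]
    · simp [Equiv.piCurry, Sigma.curry, hs, sigmaComplLabelEquiv]
  simp only [key]
  rw [← (sigmaComplLabelEquiv dim A).symm.sum_comp]
  simp only [Equiv.apply_symm_apply, Finset.mul_sum]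
  rw [Finset.sum_comm]
  refine Finset.sum_congr rfl fun u _ => ?_
  rw [Finset.sum_comm]

variable {δ : J → ℕ}

theorem trace_single_one {n : Type} [Fintype n] [DecidableEq n] (i j : n) :
    (Matrix.single i j (1 : ℂ)).trace = if i = j then 1 else 0 := by
  split_ifs with h
  · subst h; simp
  · exact Matrix.trace_single_eq_of_ne _ _ _ h

/-- Operations that act trivially on the shares in `K` do not change their reduced state. -/
theorem reduceMap_comp_tensorMap (K : Finset J)
    (Θ : ∀ j, Matrix (Fin (δ j)) (Fin (δ j)) ℂ →ₗ[ℂ] Matrix (Fin (δ j)) (Fin (δ j)) ℂ)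
    (hK : ∀ j ∈ K, Θ j = LinearMap.id) (htr : ∀ j X, (Θ j X).trace = X.trace) :
    reduceMap δ K ∘ₗ tensorMap Θ = reduceMap δ K := by
  apply LinearMap.ext
  intro X
  ext x y
  rw [LinearMap.comp_apply, ← reduce_eq_reduceMap]
  simp only [reduce, reduceMap, labelMap_apply, Matrix.of_apply, tensorMap_apply]
  rw [Finset.sum_comm]
  refine Finset.sum_congr rfl fun u _ => ?_
  rw [Finset.sum_comm]
  refine Finset.sum_congr rfl fun v _ => ?_
  rw [← Finset.mul_sum]
  have h1 : ∀ z : (∀ s : {s // s ∉ K}, Fin (δ s)), ∏ j, Θ j (Matrix.single (u j) (v j) 1)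
      ((Equiv.piEquivPiSubtypeProd (fun s => s ∈ K) fun s => Fin (δ s)).symm (x, z) j)
      ((Equiv.piEquivPiSubtypeProd (fun s => s ∈ K) fun s => Fin (δ s)).symm (y, z) j) =
      (∏ j : {j // j ∈ K}, (if u j = x j then 1 else 0) * (if v j = y j then 1 else 0)) *
      ∏ j : {j // j ∉ K}, Θ j (Matrix.single (u j) (v j) 1) (z j) (z j) := by
    intro z
    rw [prod_eq_prod_mem_mul_prod_notMem K]
    congr 1
    · refine Finset.prod_congr rfl fun j _ => ?_
      rw [hK j.1 j.2]
      simp only [Equiv.piEquivPiSubtypeProd_symm_apply, j.2, dif_pos, LinearMap.id_apply,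
        Matrix.single_apply, ← ite_and, mul_ite, mul_one, mul_zero]
      refine if_congr ?_ rfl rfl
      tauto
    · refine Finset.prod_congr rfl fun j _ => ?_
      simp [j.2]
  simp only [h1]
  rw [← Finset.mul_sum]
  -- The sum over the traced-out labels factors into one trace per `j ∉ K`, which `Θ j` preserves.
  have h2 : ∑ z : (∀ s : {s // s ∉ K}, Fin (δ s)),
      ∏ j : {j // j ∉ K}, Θ j (Matrix.single (u j) (v j) 1) (z j) (z j) =
      ∏ j : {j // j ∉ K}, if u j = v j then (1 : ℂ) else 0 := by
    rw [← Fintype.prod_sum fun (j : {j // j ∉ K}) k =>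
      Θ j (Matrix.single (u j) (v j) 1) k k]
    refine Finset.prod_congr rfl fun j _ => ?_
    rw [← trace_single_one, ← htr j]
    rfl
  rw [h2, Finset.prod_mul_distrib, prod_ite_one_eq (fun j : {j // j ∈ K} => u j) x,
    prod_ite_one_eq (fun j : {j // j ∈ K} => v j) y,
    prod_ite_one_eq (fun j : {j // j ∉ K} => u j) (fun j => v j)]
  rw [mul_ite_one_zero_mul]
  congr

/-- If the operations outside `K` produce fixed states, then the result depends only on the
reduced state of the shares in `K`. -/
theorem tensorMap_eq_of_const {b : J → Type} (K : Finset J)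
    (Θ : ∀ j, Matrix (Fin (δ j)) (Fin (δ j)) ℂ →ₗ[ℂ] Matrix (b j) (b j) ℂ)
    (σ : ∀ j, Matrix (b j) (b j) ℂ) (hK : ∀ j ∉ K, ∀ X, Θ j X = X.trace • σ j)
    (X : Matrix (∀ j, Fin (δ j)) (∀ j, Fin (δ j)) ℂ) (x y : ∀ j, b j) :
    tensorMap Θ X x y = ∑ p, ∑ r, reduceMap δ K X p r *
      ((∏ j : {j // j ∈ K}, Θ j (Matrix.single (p j) (r j) 1) (x j) (y j)) *
        ∏ j : {j // j ∉ K}, σ j (x j) (y j)) := by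
  -- Outside `K`, a matrix unit contributes its trace times `σ j`; the factor forcing `z = z'` is
  -- what turns the sum into a partial trace.
  have h1 : ∀ (p r : ∀ s : {s // s ∈ K}, Fin (δ s)) (z z' : ∀ s : {s // s ∉ K}, Fin (δ s)),
      ∏ j, Θ j (Matrix.single
        ((Equiv.piEquivPiSubtypeProd (fun s => s ∈ K) fun s => Fin (δ s)).symm (p, z) j)
        ((Equiv.piEquivPiSubtypeProd (fun s => s ∈ K) fun s => Fin (δ s)).symm (r, z') j) 1)
        (x j) (y j) =
      if z = z' then ((∏ j : {j // j ∈ K}, Θ j (Matrix.single (p j) (r j) 1) (x j) (y j)) *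
        ∏ j : {j // j ∉ K}, σ j (x j) (y j)) else 0 := by
    intro p r z z'
    rw [prod_eq_prod_mem_mul_prod_notMem K, ← mul_ite_zero]
    congr 1
    · refine Finset.prod_congr rfl fun j _ => ?_
      simp [j.2]
    · rw [← mul_boole, ← prod_ite_one_eq z z', ← Finset.prod_mul_distrib]
      refine Finset.prod_congr rfl fun j _ => ?_
      rw [hK j.1 j.2, trace_single_one]
      simp [j.2]
  rw [tensorMap_apply,
    ← (Equiv.piEquivPiSubtypeProd (fun s => s ∈ K) fun s => Fin (δ s)).symm.sum_comp,
    Fintype.sum_prod_type]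
  simp only [← (Equiv.piEquivPiSubtypeProd (fun s => s ∈ K)
    fun s => Fin (δ s)).symm.sum_comp, Fintype.sum_prod_type, h1]
  refine Finset.sum_congr rfl fun p _ => ?_
  rw [Finset.sum_comm]
  refine Finset.sum_congr rfl fun r _ => ?_
  rw [← reduce_eq_reduceMap]
  simp only [reduce, Matrix.of_apply, Finset.sum_mul, mul_ite, mul_zero]
  simp

end Concat

/-! ### Recovery and secrecy of concatenated schemes -/

namespace SharingScheme

variable {N d : ℕ} {J : Type} [Fintype J] [DecidableEq J] {δ : J → ℕ}

theorem mem_available (S : SharingScheme N d) (A : Finset (Fin N)) (s : S.Share) :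
    s ∈ S.available A ↔ S.holder s = none ∨ ∃ p ∈ A, S.holder s = some p := by
  simp [available]

theorem mem_residents (S : SharingScheme N d) (s : S.Share) :
    s ∈ S.residents ↔ S.holder s = none := by
  simp [residents]

theorem available_concat (T : Encoding d J δ) (S : ∀ j, SharingScheme N (δ j))
    (A : Finset (Fin N)) :
    (show Finset (Σ j, (S j).Share) from (concat T S).available A) =
      Finset.univ.sigma fun j => (S j).available A := by
  ext s
  rw [Finset.mem_sigma, mem_available, and_iff_right (Finset.mem_univ _)]
  exact mem_available (concat T S) A s

theorem residents_concat (T : Encoding d J δ) (S : ∀ j, SharingScheme N (δ j)) :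
    (show Finset (Σ j, (S j).Share) from (concat T S).residents) =
      Finset.univ.sigma fun j => (S j).residents := by
  ext s
  rw [Finset.mem_sigma, mem_residents, and_iff_right (Finset.mem_univ _)]
  exact mem_residents (concat T S) s

theorem card_residents_concat (T : Encoding d J δ) (S : ∀ j, SharingScheme N (δ j)) :
    (concat T S).residents.card = ∑ j, (S j).residents.card :=
  (congrArg Finset.card (residents_concat T S)).trans (Finset.card_sigma _ _)

/-- The encoding of the concatenation, with its shares grouped as pairs. -/
def concatEncoding (T : Encoding d J δ) (S : ∀ j, SharingScheme N (δ j)) :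
    Encoding d (Σ j, (S j).Share) fun s => (S s.1).dim s.2 :=
  (concat T S).encoding

theorem reduceMap_concat (T : Encoding d J δ) (S : ∀ j, SharingScheme N (δ j))
    (A : ∀ j, Finset (S j).Share) :
    reduceMap (fun s : Σ j, (S j).Share => (S s.1).dim s.2) (Finset.univ.sigma A) ∘ₗ
      (concatEncoding T S).enc =
      relabel (sigmaLabelEquiv (fun j => (S j).dim) A).symm ∘ₗ
        (tensorMap fun j => reduceMap (S j).dim (A j) ∘ₗ (S j).encoding.enc) ∘ₗ T.enc := by
  rw [← LinearMap.comp_assoc, ← reduceMap_sigma]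
  rfl

/-- Decode the inner schemes in `K`. Whatever is done to the other blocks preserves the trace, so
the reduced state on `K` is that of `T`, and the decoder of `T` applies. -/
theorem concat_recovers (hδ : ∀ j, 0 < δ j) (T : Encoding d J δ)
    (S : ∀ j, SharingScheme N (δ j)) (A : Finset (Fin N)) (K : Finset J) (hT : T.Recovers K)
    (hS : ∀ j ∈ K, (S j).encoding.Recovers ((S j).available A)) :
    (concat T S).encoding.Recovers ((concat T S).available A) := by
  refine Eq.mpr (congrArg (concatEncoding T S).Recovers (available_concat T S A)) ?_
  rw [Encoding.recovers_iff]
  have hR : ∀ j, ∃ R, IsChannel R ∧ (j ∈ K →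
      R ∘ₗ reduceMap (S j).dim ((S j).available A) ∘ₗ (S j).encoding.enc = LinearMap.id) := by
    intro j
    by_cases hj : j ∈ K
    · obtain ⟨R, h1, h2⟩ := (Encoding.recovers_iff _ _).1 (hS j hj)
      exact ⟨R, h1, fun _ => h2⟩
    -- A block outside `K` is discarded and replaced by the state `|0⟩`, which needs positive
    -- dimension.
    · exact ⟨labelMap (fun _ => ⟨0, hδ j⟩) id, labelMap_isChannel _ _ fun _ _ _ h => h,
        fun h => absurd h hj⟩
  choose R hRc hR using hR
  obtain ⟨R', hR', hT⟩ := (Encoding.recovers_iff _ _).1 hT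
  refine ⟨R' ∘ₗ reduceMap δ K ∘ₗ tensorMap R ∘ₗ
    relabel (sigmaLabelEquiv (fun j => (S j).dim) fun j => (S j).available A),
    hR'.comp ((reduceMap_isChannel K).comp ((tensorMap_isChannel R hRc).comp
      (relabel_isChannel _))), ?_⟩
  have hrel : ∀ {a b : Type} (f : a ≃ b) (X), relabel f (relabel f.symm X) = X := by
    intro a b f X; ext; simp [relabel]
  have h3 : reduceMap δ K ∘ₗ tensorMap R ∘ₗ tensorMap (fun j =>
      reduceMap (S j).dim ((S j).available A) ∘ₗ (S j).encoding.enc) = reduceMap δ K := by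
    rw [tensorMap_comp]
    refine reduceMap_comp_tensorMap K _ (fun j hj => hR j hj) fun j X => ?_
    exact ((hRc j).comp ((reduceMap_isChannel _).comp (S j).encoding.isChannel)).trace_apply X
  rw [reduceMap_concat, ← hT]
  apply LinearMap.ext
  intro X
  simp only [LinearMap.comp_apply, hrel]
  have := LinearMap.congr_fun h3 (T.enc X)
  simp only [LinearMap.comp_apply] at this
  rw [this]

/-- Even if the blocks in `K` are fully known, the others contribute fixed states, so only the
reduced state of `T` on `K` can matter, and that is constant. -/
theorem concat_noInfo (T : Encoding d J δ) (S : ∀ j, SharingScheme N (δ j))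
    (A : Finset (Fin N)) (K : Finset J) (hT : T.NoInfo K)
    (hS : ∀ j ∉ K, (S j).encoding.NoInfo ((S j).available A)) :
    (concat T S).encoding.NoInfo ((concat T S).available A) := by
  refine Eq.mpr (congrArg (concatEncoding T S).NoInfo (available_concat T S A)) ?_
  rw [Encoding.noInfo_iff]
  have hσ : ∀ j, ∃ σ, j ∉ K → ∀ X, (reduceMap (S j).dim ((S j).available A) ∘ₗ
      (S j).encoding.enc) X = X.trace • σ := by
    intro j
    by_cases hj : j ∈ K
    · exact ⟨0, fun h => absurd hj h⟩
    · obtain ⟨σ, hσ⟩ := (Encoding.noInfo_iff _ _).1 (hS j hj)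
      exact ⟨σ, fun _ => hσ⟩
  choose σ hσ using hσ
  obtain ⟨τ, hτ⟩ := (Encoding.noInfo_iff _ _).1 hT
  refine ⟨relabel (sigmaLabelEquiv (fun j => (S j).dim) fun j => (S j).available A).symm
    (Matrix.of fun x y => ∑ p, ∑ r, τ p r * ((∏ j : {j // j ∈ K},
      (reduceMap (S j).dim ((S j).available A) ∘ₗ (S j).encoding.enc)
        (Matrix.single (p j) (r j) 1) (x j) (y j)) *
      ∏ j : {j // j ∉ K}, σ j (x j) (y j))), fun X => ?_⟩
  rw [← map_smul]
  refine (LinearMap.congr_fun (reduceMap_concat T S _) X).trans ?_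
  simp only [LinearMap.comp_apply]
  congr 1
  ext x y
  have h := tensorMap_eq_of_const K (fun j => reduceMap (S j).dim ((S j).available A) ∘ₗ
    (S j).encoding.enc) σ hσ (T.enc X) x y
  simp only [hτ, Matrix.smul_apply, smul_eq_mul, mul_assoc, ← Finset.mul_sum] at h
  exact h

end SharingScheme

/-! ### The share kept by the dealer, and necessity of monotonicity -/

theorem Encoding.recovers_of_enc_eq_relabel {d : ℕ} (T : Encoding d Unit fun _ => d)
    (hT : T.enc = relabel (Equiv.funUnique Unit (Fin d)).symm) {A : Finset Unit} (hA : () ∈ A) :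
    T.Recovers A := by
  rw [Encoding.recovers_iff]
  refine ⟨labelMap (fun x => x ⟨(), hA⟩) (fun _ => ()), labelMap_isChannel _ _ ?_, ?_⟩
  · intro x y h _
    funext i
    exact h
  · have h1 : (LinearMap.id : Matrix (Fin d) (Fin d) ℂ →ₗ[ℂ] _) = relabel (Equiv.refl _) := rfl
    rw [hT, h1, relabel_eq_labelMap, relabel_eq_labelMap, reduceMap, labelMap_comp,
      labelMap_comp]
    refine labelMap_congr (fun x => rfl) fun x y => ?_
    simp only [Prod.mk.injEq, true_and, iff_true]
    refine ⟨funext fun s => absurd hA s.2, trivial⟩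

namespace SharingScheme

theorem keep_recovers (N d : ℕ) (A : Finset (Fin N)) :
    (keep N d).encoding.Recovers ((keep N d).available A) :=
  Encoding.recovers_of_enc_eq_relabel _ rfl
    ((mem_available (keep N d) A ()).2 (Or.inl rfl))

theorem card_residents_keep (N d : ℕ) : (keep N d).residents.card = 1 := by
  have : (keep N d).residents = (Finset.univ : Finset Unit) :=
    Finset.filter_true_of_mem fun _ _ => rfl
  rw [this]
  rfl

theorem Realizes.isUpperSet {N d : ℕ} (hd : 2 ≤ d) {S : SharingScheme N d}
    {Γ : Set (Finset (Fin N))} (hS : S.Realizes Γ) : IsUpperSet Γ := by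
  intro A B hAB hA
  by_contra hB
  refine Encoding.not_recovers_of_noInfo hd ((hS B).2 hB) (((hS A).1 hA).mono fun s => ?_)
  rw [mem_available, mem_available]
  exact Or.imp_right fun ⟨p, hp, h⟩ => ⟨p, hAB hp, h⟩

end SharingScheme

/-! ### Existence of partial link classifications -/

/-- Among partitions into intersecting classes, take one with the fewest classes. If two classes
violated the disjointness condition, every cross pair would intersect and their union would be a
legitimate class, contradicting minimality. -/
theorem exists_isPartialLinkClassification {N : ℕ} {G : Finset (Finset (Fin N))}
    (hG : ∅ ∉ G) : ∃ π : Finpartition G, IsPartialLinkClassification π := by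
  classical
  let Linked : Finpartition G → Prop := fun π =>
    ∀ c ∈ π.parts, ∀ α ∈ c, ∀ β ∈ c, (α ∩ β).Nonempty
  have hex : ∃ k, ∃ π : Finpartition G, Linked π ∧ π.parts.card = k := by
    -- Singletons qualify, because a nonempty set meets itself.
    refine ⟨_, ⊥, fun c hc α hα β hβ => ?_, rfl⟩
    obtain ⟨γ, hγ, rfl⟩ := Finpartition.mem_bot_iff.1 hc
    rw [Finset.mem_singleton] at hα hβ
    subst hα hβ
    rw [Finset.inter_self, Finset.nonempty_iff_ne_empty]
    rintro rfl
    exact hG hγ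
  obtain ⟨π, hπ, hcard⟩ := Nat.find_spec hex
  refine ⟨π, hπ, fun c hc c' hc' hne => ?_⟩
  by_contra hcon
  push Not at hcon
  let parts := insert (c ∪ c') ((π.parts.erase c).erase c')
  have hmem : ∀ t, t ∈ parts ↔ t = c ∪ c' ∨ (t ≠ c' ∧ t ≠ c ∧ t ∈ π.parts) := by
    intro t; simp [parts]
  let π' : Finpartition G := Finpartition.ofExistsUnique parts
    (by
      intro t ht
      rcases (hmem t).1 ht with rfl | ⟨_, _, ht⟩
      · exact Finset.union_subset (π.le hc) (π.le hc')
      · exact π.le ht)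
    (by
      intro α hα
      obtain ⟨p, ⟨hp, hαp⟩, huniq⟩ := π.existsUnique_mem hα
      by_cases hpc : p = c ∨ p = c'
      · refine ⟨c ∪ c', ⟨(hmem _).2 (Or.inl rfl), ?_⟩, ?_⟩
        · rw [Finset.mem_union]
          rcases hpc with rfl | rfl
          · exact Or.inl hαp
          · exact Or.inr hαp
        · rintro t ⟨ht, hαt⟩
          rcases (hmem t).1 ht with rfl | ⟨h1, h2, ht⟩
          · rfl
          · have := huniq t ⟨ht, hαt⟩
            subst this
            exact absurd hpc (by tauto)
      · push Not at hpc
        refine ⟨p, ⟨(hmem _).2 (Or.inr ⟨hpc.2, hpc.1, hp⟩), hαp⟩, ?_⟩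
        rintro t ⟨ht, hαt⟩
        rcases (hmem t).1 ht with rfl | ⟨h1, h2, ht⟩
        · rcases Finset.mem_union.1 hαt with h | h
          · exact absurd (huniq c ⟨hc, h⟩).symm hpc.1
          · exact absurd (huniq c' ⟨hc', h⟩).symm hpc.2
        · exact huniq t ⟨ht, hαt⟩)
    (by
      intro h
      rcases (hmem _).1 h with h | ⟨_, _, h⟩
      · have h2 : c = ∅ := Finset.subset_empty.1 (h ▸ Finset.subset_union_left)
        exact π.bot_notMem (by rw [Finset.bot_eq_empty, ← h2]; exact hc)
      · exact π.bot_notMem h)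
  have hparts : π'.parts = parts := rfl
  have hlinked : Linked π' := by
    intro t ht α hα β hβ
    rcases (hmem t).1 ht with rfl | ⟨_, _, ht⟩
    · rcases Finset.mem_union.1 hα with h1 | h1 <;> rcases Finset.mem_union.1 hβ with h2 | h2
      · exact hπ c hc α h1 β h2
      · exact hcon α h1 β h2
      · rw [Finset.inter_comm]
        exact hcon β h2 α h1
      · exact hπ c' hc' α h1 β h2
    · exact hπ t ht α hα β hβ
  have hlt : π'.parts.card < Nat.find hex := by
    rw [← hcard, hparts]
    have h1 : ((π.parts.erase c).erase c').card + 1 = (π.parts.erase c).card :=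
      Finset.card_erase_add_one (Finset.mem_erase.2 ⟨hne.symm, hc'⟩)
    have h2 : (π.parts.erase c).card + 1 = π.parts.card := Finset.card_erase_add_one hc
    have h3 : parts.card ≤ _ := Finset.card_insert_le _ _
    omega
  exact Nat.find_min hex hlt ⟨π', hlinked, rfl⟩

theorem exists_card_parts_eq_linkNumber {N : ℕ} {G : Finset (Finset (Fin N))} (hG : ∅ ∉ G) :
    ∃ π : Finpartition G, IsPartialLinkClassification π ∧ π.parts.card = linkNumber G := by
  obtain ⟨π, hπ⟩ := exists_isPartialLinkClassification hG
  exact Nat.sInf_mem (s := {k | ∃ π : Finpartition G,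
    IsPartialLinkClassification π ∧ π.parts.card = k}) ⟨_, π, hπ, rfl⟩

/-! ### The two-layer scheme -/

/-- Correctness rests on the intersection property within classes; the number of classes enters only
as the threshold and in the resident count. -/
theorem exists_concat_realizes {N : ℕ} {Γ G : Finset (Finset (Fin N))}
    (hΓ : IsUpperSet (Γ : Set (Finset (Fin N)))) (hGΓ : G ⊆ Γ)
    (hgen : ∀ A ∈ Γ, ∃ B ∈ G, B ⊆ A) (π : Finpartition G)
    (hπ : ∀ c ∈ π.parts, ∀ α ∈ c, ∀ β ∈ c, (α ∩ β).Nonempty) {l : ℕ} (hl : 0 < l)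
    (hcard : π.parts.card = l) {d q : ℕ} (hd : 0 < d) (hq : q.Prime) (hdq : d ≤ q)
    (hlq : 2 * l - 1 ≤ q) :
    ∃ (T : Encoding d ({c // c ∈ π.parts} ⊕ Fin (l - 1)) fun _ => q)
      (C : {c // c ∈ π.parts} → SharingScheme N q),
      T.IsThreshold l (2 * l - 1) ∧
      (∀ c, (C c).RealizesConventionally {A | ∃ B ∈ c.1, B ⊆ A} ∧ ∀ s, (C c).dim s = q) ∧
      (SharingScheme.concat T (Sum.elim C fun _ => SharingScheme.keep N q)).Realizes
        (Γ : Set (Finset (Fin N))) ∧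
      (SharingScheme.concat T
        (Sum.elim C fun _ => SharingScheme.keep N q)).residents.card = l - 1 := by
  have : NeZero q := ⟨hq.ne_zero⟩
  obtain ⟨T, hT⟩ := exists_isThreshold (ι := {c // c ∈ π.parts} ⊕ Fin (l - 1)) hd hq hdq hl
    (by rw [Fintype.card_sum, Fintype.card_coe, Fintype.card_fin, hcard]; omega) hlq
  choose C hC hCdim using fun c : {c // c ∈ π.parts} =>
    exists_realizesConventionally (q := q) c.1 (hπ c.1 c.2)
  let kept : Finset ({c // c ∈ π.parts} ⊕ Fin (l - 1)) :=
    Finset.univ.map Function.Embedding.inr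
  have hkept : kept.card = l - 1 := by simp [kept]
  refine ⟨T, C, hT, fun c => ⟨hC c, hCdim c⟩, fun A => ⟨fun hA => ?_, fun hA => ?_⟩, ?_⟩
  · obtain ⟨B, hB, hBA⟩ := hgen A hA
    obtain ⟨c, hc, hBc⟩ := π.exists_mem hB
    refine SharingScheme.concat_recovers (fun _ => hq.pos) T _ A
      (insert (Sum.inl ⟨c, hc⟩) kept) ((hT.2 _).1 ?_) ?_
    · rw [Finset.card_insert_of_notMem (by simp [kept]), hkept]; omega
    · rintro (c' | i) hj
      · have hc' : c' = ⟨c, hc⟩ := by simpa [kept] using hj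
        subst hc'
        exact ((hC _).1 A).1 ⟨B, hBc, hBA⟩
      · exact SharingScheme.keep_recovers N q A
  -- The resident shares are one short of the threshold. By monotonicity an unauthorized `A`
  -- contains no member of any class.
  · refine SharingScheme.concat_noInfo T _ A kept ((hT.2 _).2 (by omega)) ?_
    rintro (c | i) hj
    · refine ((hC c).1 A).2 ?_
      rintro ⟨B, hB, hBA⟩
      exact hA (hΓ hBA (hGΓ (π.le c.2 hB)))
    · exact absurd (by simp [kept]) hj
  · rw [SharingScheme.card_residents_concat, Fintype.sum_sum_type]
    have h1 : ∀ c, (C c).residents.card = 0 := fun c => by rw [(hC c).2, Finset.card_empty]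
    simp only [Sum.elim_inl, Sum.elim_inr, h1, SharingScheme.card_residents_keep]
    simp

/-! ### The main theorem -/

theorem mainTheorem1 (N : ℕ) (Γ : Finset (Finset (Fin N))) (hΓ : Γ.Nonempty) (hne : ∅ ∉ Γ) :
    -- an assisted scheme exists iff `Γ` is monotone
    (∀ d : ℕ, 2 ≤ d →
      ((∃ S : SharingScheme N d, S.Realizes (Γ : Set (Finset (Fin N)))) ↔
        IsUpperSet (Γ : Set (Finset (Fin N))))) ∧
    -- for monotone `Γ`, listed through any subfamily `G` that generates it
    (IsUpperSet (Γ : Set (Finset (Fin N))) →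
      ∀ G : Finset (Finset (Fin N)), G ⊆ Γ → (∀ A ∈ Γ, ∃ B ∈ G, B ⊆ A) →
        -- at most `λ - 1` resident shares are needed
        (∀ d : ℕ, 2 ≤ d → ∃ S : SharingScheme N d,
          S.Realizes (Γ : Set (Finset (Fin N))) ∧ S.residents.card + 1 ≤ linkNumber G) ∧
        -- the two-layer scheme of any smallest classification, all shares of dimension `q`
        (∀ π : Finpartition G, IsPartialLinkClassification π → π.parts.card = linkNumber G →
          ∀ d q : ℕ, 2 ≤ d → q.Prime → d ≤ q → 2 * linkNumber G - 1 ≤ q →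
            ∃ (T : Encoding d ({c // c ∈ π.parts} ⊕ Fin (linkNumber G - 1)) fun _ => q)
              (C : {c // c ∈ π.parts} → SharingScheme N q),
              T.IsThreshold (linkNumber G) (2 * linkNumber G - 1) ∧
              (∀ c, (C c).RealizesConventionally {A | ∃ B ∈ c.1, B ⊆ A} ∧
                ∀ s, (C c).dim s = q) ∧
              (SharingScheme.concat T
                (Sum.elim C fun _ => SharingScheme.keep N q)).Realizes
                  (Γ : Set (Finset (Fin N))) ∧
              (SharingScheme.concat T
                (Sum.elim C fun _ => SharingScheme.keep N q)).residents.card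
                  = linkNumber G - 1)) := by
  have two_layer : IsUpperSet (Γ : Set (Finset (Fin N))) →
      ∀ G : Finset (Finset (Fin N)), G ⊆ Γ → (∀ A ∈ Γ, ∃ B ∈ G, B ⊆ A) →
        0 < linkNumber G ∧ ∀ d : ℕ, 2 ≤ d → ∃ S : SharingScheme N d,
          S.Realizes (Γ : Set (Finset (Fin N))) ∧ S.residents.card + 1 ≤ linkNumber G := by
    intro hup G hG hgen
    obtain ⟨π, hπ, hcard⟩ := exists_card_parts_eq_linkNumber fun h => hne (hG h)
    -- A nonempty `Γ` forces at least one class, so the subtraction in `λ - 1` is not truncated.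
    have hpos : 0 < linkNumber G := by
      obtain ⟨A, hA⟩ := hΓ
      obtain ⟨B, hB, _⟩ := hgen A hA
      obtain ⟨c, hc, _⟩ := π.exists_mem hB
      rw [← hcard]
      exact Finset.card_pos.2 ⟨c, hc⟩
    refine ⟨hpos, fun d hd => ?_⟩
    obtain ⟨q, hle, hq⟩ := Nat.exists_infinite_primes (max d (2 * linkNumber G - 1))
    obtain ⟨T, C, _, _, hreal, hres⟩ := exists_concat_realizes hup hG hgen π hπ.1 hpos hcard
      (by omega : 0 < d) hq ((le_max_left _ _).trans hle) ((le_max_right _ _).trans hle)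
    exact ⟨_, hreal, by rw [hres]; omega⟩
  refine ⟨fun d hd => ⟨fun ⟨S, hS⟩ => hS.isUpperSet hd, fun hup => ?_⟩,
    fun hup G hG hgen => ⟨(two_layer hup G hG hgen).2, ?_⟩⟩
  · obtain ⟨S, hS, _⟩ := (two_layer hup Γ subset_rfl fun A hA => ⟨A, hA, subset_rfl⟩).2 d hd
    exact ⟨S, hS⟩
  · intro π hπ hcard d q hd hq hdq hlq
    exact exists_concat_realizes hup hG hgen π hπ.1 (two_layer hup G hG hgen).1 hcard
      (by omega) hq hdq hlq
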